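/- Setting. An input is a finite set $Q$ of jobs; each job $q$ has a processing time $p_q>0$, a weight $w_q>0$, a release time $r_q\ge 0$ and a predicted processing time $\tilde p_q>0$. A schedule processes, on a single machine with preemption, at most one job at any time, and only pending jobs (released and not yet completed). Its weighted flow time is $\int_0^\infty \sum_{q \text{ pending at } t} w_q\,dt=\sum_{q} w_q (c_q-r_q)$, where $c_q$ is the completion time of $q$; $\mathrm{OPT}$ is the infimum of the weighted flow time over all schedules. At any time the online scheduler sees only the weights and predictions of the pending jobs and which of them are partial (already processed for a positive amount of time), not the values $p_q$. Let $D=\max_{q,q'\in Q} \frac{w_q/p_q}{w_{q'}/p_{q'}}$. Algorithm. For a parameter $\mu$, put $\lambda=16\mu+6$. The weight class of a job is $\mathrm{wc}(q)=\lceil\log_\lambda w_q\rceil$, its rounded weight is $w'_q=\lambda^{\mathrm{wc}(q)}$, and its estimated inverse density class is $\mathrm{idc}(q)=\lfloor \log_2(\tilde p_q/w'_q)\rfloor$. At any time at which some job is pending, let $i$ be the largest weight class of a pending job, let $j$ be the minimal integer such that the pending jobs with $\mathrm{idc}=j$ have total rounded weight at least $\lambda^i$, and let $i'$ be the largest weight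 class of a pending job with $\mathrm{idc}=j$. The algorithm processes a pending job $q$ with $\mathrm{wc}(q)=i'$ and $\mathrm{idc}(q)=j$, choosing a partial one if such a job exists (other ties are broken arbitrarily; a decision is carried out for a positive length of time). Theorem. The algorithm is $\mu$-robust and $O(\mu^3\log(\mu D))$-competitive. That is, there is an absolute constant $C>0$ such that for every $\mu\ge 1$ and every input with $\tilde p_q\le p_q<\mu\tilde p_q$ for all jobs $q$, the algorithm with parameter $\mu$ produces a schedule, and every schedule $\sigma$ it can produce has weighted flow time $$F(\sigma)\le C\,\mu^3\,\bigl(1+\log(\mu D)\bigr)\cdot \mathrm{OPT}.$$ -/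

import Mathlib

open MeasureTheory Filter Topology
open scoped ENNReal

noncomputable section

namespace SPPT

/-- An input of scheduling with predicted processing times, with job set `ι`.
`processingTime` is the real processing time, `prediction` the predicted one. -/
structure Instance (ι : Type) where
  processingTime : ι → ℝ
  weight : ι → ℝ
  release : ι → ℝ
  prediction : ι → ℝ
  processingTime_pos : ∀ q, 0 < processingTime q
  weight_pos : ∀ q, 0 < weight q
  release_nonneg : ∀ q, 0 ≤ release q
  prediction_pos : ∀ q, 0 < prediction q

/-- The amount of time that `σ` has spent on job `q` before time `t`. Here `σ s = some q` means
that the machine processes `q` at time `s`, and `σ s = none` that it is idle. -/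
def processed {ι : Type} (σ : ℝ → Option ι) (q : ι) (t : ℝ) : ℝ :=
  volume.real {s : ℝ | s ∈ Set.Ico 0 t ∧ σ s = some q}

namespace Instance

variable {ι : Type} (I : Instance ι)

/-- Remaining processing time (volume) of `q` at time `t`. -/
def remaining (σ : ℝ → Option ι) (q : ι) (t : ℝ) : ℝ :=
  I.processingTime q - processed σ q t

/-- `q` is released and not completed at time `t`. -/
def IsPending (σ : ℝ → Option ι) (t : ℝ) (q : ι) : Prop :=
  I.release q ≤ t ∧ 0 < I.remaining σ q t

/-- Preemptive schedules on one machine: at every time at most one job is processed, and only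
pending jobs are processed. -/
structure IsSchedule (σ : ℝ → Option ι) : Prop where
  measurable : ∀ q, MeasurableSet {t : ℝ | σ t = some q}
  pending : ∀ t q, σ t = some q → I.IsPending σ t q

section Finite

variable [Fintype ι]

open Classical in
/-- The set of pending jobs at time `t`. -/
def pendingJobs (σ : ℝ → Option ι) (t : ℝ) : Finset ι :=
  Finset.univ.filter (fun q => I.IsPending σ t q)

/-- Weighted flow time: the integral over time of the total weight of the pending jobs. It is
infinite if some job is never completed. -/
def flowTime (σ : ℝ → Option ι) : ℝ≥0∞ :=
  ∫⁻ t in Set.Ici (0 : ℝ), ENNReal.ofReal (∑ q ∈ I.pendingJobs σ t, I.weight q)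

end Finite

/-- The optimal (offline) weighted flow time. -/
def opt [Fintype ι] : ℝ≥0∞ :=
  ⨅ σ : {σ : ℝ → Option ι // I.IsSchedule σ}, I.flowTime σ.1

/-- The density of a job, with respect to its real processing time and original weight. -/
def density (q : ι) : ℝ := I.weight q / I.processingTime q

/-- The maximum ratio `D` of the densities of two jobs of the input. -/
def densityRatio : ℝ := ⨆ x : ι × ι, I.density x.1 / I.density x.2

/-- The predictions are correct up to a factor `μ`, with one-sided error. -/
def HasDistortion (μ : ℝ) : Prop :=
  ∀ q, I.prediction q ≤ I.processingTime q ∧ I.processingTime q < μ * I.prediction q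

end Instance

/-- A nonclairvoyant scheduling rule. Its arguments are what the scheduler sees at a point in
time: weights and predictions of the jobs, the set of living (pending) jobs, and the set of partial
jobs (those already processed for some time). Real processing times are not visible. The value is
the set of jobs that the rule permits to be processed. -/
abbrev Rule : Type 1 :=
  ∀ ι : Type, (weight prediction : ι → ℝ) → (alive : Finset ι) → (partialJobs : Set ι) → Set ι

/-- `σ` is a schedule that results from applying the rule `R` at every point in time. Right
constancy says that a processing decision is carried out for a positive length of time. -/
structure IsRun (R : Rule) {ι : Type} [Fintype ι] (I : Instance ι) (σ : ℝ → Option ι) : Prop where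
  schedule : I.IsSchedule σ
  rightConstant : ∀ t : ℝ, 0 ≤ t → ∀ᶠ s in 𝓝[≥] t, σ s = σ t
  follows : ∀ t : ℝ, 0 ≤ t → (I.pendingJobs σ t).Nonempty →
    ∃ q ∈ R ι I.weight I.prediction (I.pendingJobs σ t) {q | 0 < processed σ q t}, σ t = some q

/-- The rule `R` is `μ`-robust with competitive ratio `c`, a function of the input: on every input
of distortion `μ` it produces a schedule, and every schedule that it can produce (whichever way
its free choices are made) costs at most `c` times the optimum. -/
def IsRobustCompetitive (R : Rule) (μ : ℝ)
    (c : ∀ (ι : Type) [Fintype ι], Instance ι → ℝ) : Prop :=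
  ∀ (ι : Type) [Fintype ι] (I : Instance ι), I.HasDistortion μ →
    (∃ σ, IsRun R I σ) ∧
    ∀ σ, IsRun R I σ → I.flowTime σ ≤ ENNReal.ofReal (c ι I) * I.opt

/-- The base `λ = 16 μ + 6` of the rounding of the weights. -/
def base (μ : ℝ) : ℝ := 16 * μ + 6

/-- The weight class of a job of original weight `w`: the exponent of the least integer power of
`λ` that is at least `w`. -/
def weightClass (μ w : ℝ) : ℤ := ⌈Real.logb (base μ) w⌉

/-- The weight rounded up to an integer power of `λ`. -/
def roundedWeight (μ w : ℝ) : ℝ := base μ ^ weightClass μ w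

/-- The estimated inverse density class of a job of original weight `w` and prediction `p`. -/
def eiClass (μ w p : ℝ) : ℤ := ⌊Real.logb 2 (p / roundedWeight μ w)⌋

open Classical in
/-- Algorithm "Scheduling with Predictions -- Weighted": let `i` be the largest weight class of a
living job, `j` the minimal estimated inverse density class whose living jobs have total rounded
weight at least `λ ^ i`, and `i'` the maximum weight class of a living job of class `j`; process a
living job of weight class `i'` and estimated inverse density class `j`, preferring a partial one
if it exists. -/
def weightedRule (μ : ℝ) : Rule := fun ι weight prediction alive partialJobs =>
  let wc : ι → ℤ := fun q => weightClass μ (weight q)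
  let idc : ι → ℤ := fun q => eiClass μ (weight q) (prediction q)
  {q | ∃ i j i' : ℤ,
    IsGreatest {k | ∃ x ∈ alive, wc x = k} i ∧
    IsLeast {k | base μ ^ i ≤ ∑ x ∈ alive.filter (fun x => idc x = k),
      roundedWeight μ (weight x)} j ∧
    IsGreatest {k | ∃ x ∈ alive, idc x = j ∧ wc x = k} i' ∧
    (q ∈ alive ∧ wc q = i' ∧ idc q = j) ∧
    ((∃ x ∈ alive, wc x = i' ∧ idc x = j ∧ x ∈ partialJobs) → q ∈ partialJobs)}

end SPPT

end

noncomputable section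

namespace SPPT

variable {ι : Type}

/-! The argument compares a run `σ` with an arbitrary schedule `τ` at each fixed time. Let `W` be
the rounded weight of the jobs pending in `τ`, and call a density class the set of jobs with a
common `idc`. It suffices that every density class has pending rounded weight O(μ²)·`W` in `σ`:
there are O(1 + log(μD)) density classes (`HasDistortion.card_image_idc_le`), undoing the rounding
costs a factor λ = O(μ), and integrating over time gives the theorem.

Within a density class, weight and volume agree up to a factor O(μ), except for jobs whose volume
has been partly used up. Preferring partial jobs leaves at most one of these per weight class
(`IsRun.eq_of_partial`), so their weights form a geometric sum, and weight is controlled by volume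
(`IsRun.sum_rounded_le`).

Volume is controlled by `IsRun.excess_le`, under 4μ`W` < λ^i. Take the jobs of weight class at least
`i` or density class at most `k`, and go back to the last moment at which `σ` was not working on
them; since then `σ` has not fallen further behind `τ`. At that moment, either every pending weight
class was below `i` and minimality of the chosen density class bounds the volume, or a higher
density class held much volume in light jobs. In the second case that volume is still there now. For
the highest density class with that much light volume the second case cannot occur, so the bound
holds at it, and the value of λ makes this contradictory. As `k` tends to -∞, the bound also shows
that `σ` has no pending job of weight class at least `i` (`IsRun.wc_lt`). -/

/-! ### Processing time as a function of time -/

lemma processed_nonneg (σ : ℝ → Option ι) (q : ι) (t : ℝ) : 0 ≤ processed σ q t :=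
  measureReal_nonneg

lemma processed_of_nonpos (σ : ℝ → Option ι) (q : ι) {t : ℝ} (ht : t ≤ 0) :
    processed σ q t = 0 := by
  have : {s : ℝ | s ∈ Set.Ico 0 t ∧ σ s = some q} = ∅ := by
    ext s
    simp only [Set.mem_ofPred_eq, Set.mem_Ico, Set.mem_empty_iff_false, iff_false]
    rintro ⟨⟨h1, h2⟩, -⟩
    linarith
  rw [processed, this, measureReal_empty]

lemma volume_Ico_inter_ne_top (a b : ℝ) (P : ℝ → Prop) :
    volume {s : ℝ | s ∈ Set.Ico a b ∧ P s} ≠ ∞ :=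
  ((measure_mono fun _ hs => hs.1).trans_lt measure_Ico_lt_top).ne

lemma processed_mono (σ : ℝ → Option ι) (q : ι) : Monotone (processed σ q) := by
  intro a b hab
  exact measureReal_mono (fun s hs => ⟨⟨hs.1.1, hs.1.2.trans_le hab⟩, hs.2⟩)
    (volume_Ico_inter_ne_top _ _ _)

lemma processed_le_add (σ : ℝ → Option ι) (q : ι) {a b : ℝ} (hab : a ≤ b) :
    processed σ q b ≤ processed σ q a + (b - a) := by
  have h : processed σ q b ≤
      volume.real ({s : ℝ | s ∈ Set.Ico 0 a ∧ σ s = some q} ∪ Set.Ico a b) := by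
    refine measureReal_mono ?_ ?_
    · rintro s ⟨⟨h0, h1⟩, h2⟩
      rcases lt_or_ge s a with h | h
      · exact Or.inl ⟨⟨h0, h⟩, h2⟩
      · exact Or.inr ⟨h, h1⟩
    · exact ((measure_union_le _ _).trans_lt (ENNReal.add_lt_top.2
        ⟨(volume_Ico_inter_ne_top _ _ _).lt_top, measure_Ico_lt_top⟩)).ne
  refine h.trans ((measureReal_union_le _ _).trans ?_)
  rw [Real.volume_real_Ico_of_le hab]
  rfl

lemma continuous_processed (σ : ℝ → Option ι) (q : ι) : Continuous (processed σ q) := by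
  refine (LipschitzWith.of_le_add (f := processed σ q) fun x y => ?_).continuous
  rcases le_total x y with h | h
  · exact (processed_mono σ q h).trans (le_add_of_nonneg_right dist_nonneg)
  · rw [Real.dist_eq, abs_of_nonneg (sub_nonneg.2 h)]
    exact processed_le_add σ q h

lemma processed_eq_of_forall_ne (σ : ℝ → Option ι) (q : ι) {a b : ℝ} (hab : a ≤ b)
    (h : ∀ s ∈ Set.Ioo a b, σ s ≠ some q) : processed σ q b = processed σ q a := by
  refine le_antisymm ?_ (processed_mono σ q hab)
  have : processed σ q b ≤
      volume.real ({s : ℝ | s ∈ Set.Ico 0 a ∧ σ s = some q} ∪ {a}) := by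
    refine measureReal_mono ?_ ?_
    · rintro s ⟨⟨h0, h1⟩, h2⟩
      rcases lt_trichotomy s a with h' | h' | h'
      · exact Or.inl ⟨⟨h0, h'⟩, h2⟩
      · exact Or.inr h'
      · exact absurd h2 (h s ⟨h', h1⟩)
    · exact ((measure_union_le _ _).trans_lt (ENNReal.add_lt_top.2
        ⟨(volume_Ico_inter_ne_top _ _ _).lt_top, by simp⟩)).ne
  refine this.trans ((measureReal_union_le _ _).trans ?_)
  simp [processed, measureReal_def]

lemma processed_eq_add_of_forall_eq (σ : ℝ → Option ι) (q : ι) {a b : ℝ} (ha : 0 ≤ a)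
    (hab : a ≤ b) (h : ∀ s ∈ Set.Ico a b, σ s = some q) :
    processed σ q b = processed σ q a + (b - a) := by
  have : {s : ℝ | s ∈ Set.Ico 0 b ∧ σ s = some q} =
      {s : ℝ | s ∈ Set.Ico 0 a ∧ σ s = some q} ∪ Set.Ico a b := by
    ext s
    constructor
    · rintro ⟨⟨h0, h1⟩, h2⟩
      rcases lt_or_ge s a with h | h
      · exact Or.inl ⟨⟨h0, h⟩, h2⟩
      · exact Or.inr ⟨h, h1⟩
    · rintro (⟨⟨h0, h1⟩, h2⟩ | h1)
      · exact ⟨⟨h0, h1.trans_le hab⟩, h2⟩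
      · exact ⟨⟨ha.trans h1.1, h1.2⟩, h s h1⟩
  rw [processed, this, measureReal_union _ measurableSet_Ico (volume_Ico_inter_ne_top _ _ _)
    measure_Ico_lt_top.ne, Real.volume_real_Ico_of_le hab]
  · rfl
  · rw [Set.disjoint_left]
    rintro s ⟨⟨_, h1⟩, _⟩ ⟨h2, _⟩
    linarith

lemma processed_congr {σ τ : ℝ → Option ι} (q : ι) {t : ℝ}
    (h : ∀ s < t, σ s = some q ↔ τ s = some q) : processed σ q t = processed τ q t := by
  have : {s : ℝ | s ∈ Set.Ico 0 t ∧ σ s = some q} = {s : ℝ | s ∈ Set.Ico 0 t ∧ τ s = some q} := by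
    ext s
    exact and_congr_right fun hs => h s hs.2
  rw [processed, this, processed]

lemma processed_sub {σ : ℝ → Option ι} {q : ι} (hm : MeasurableSet {t : ℝ | σ t = some q})
    {a b : ℝ} (ha : 0 ≤ a) (hab : a ≤ b) :
    processed σ q b - processed σ q a = volume.real {s : ℝ | s ∈ Set.Ico a b ∧ σ s = some q} := by
  have : {s : ℝ | s ∈ Set.Ico 0 b ∧ σ s = some q} =
      {s : ℝ | s ∈ Set.Ico 0 a ∧ σ s = some q} ∪ {s : ℝ | s ∈ Set.Ico a b ∧ σ s = some q} := by
    ext s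
    constructor
    · rintro ⟨⟨h0, h1⟩, h2⟩
      rcases lt_or_ge s a with h | h
      · exact Or.inl ⟨⟨h0, h⟩, h2⟩
      · exact Or.inr ⟨⟨h, h1⟩, h2⟩
    · rintro (⟨⟨h0, h1⟩, h2⟩ | ⟨h1, h2⟩)
      · exact ⟨⟨h0, h1.trans_le hab⟩, h2⟩
      · exact ⟨⟨ha.trans h1.1, h1.2⟩, h2⟩
  have hm' : MeasurableSet {s : ℝ | s ∈ Set.Ico a b ∧ σ s = some q} := measurableSet_Ico.inter hm
  rw [processed, this, measureReal_union _ hm'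
    (volume_Ico_inter_ne_top _ _ _) (volume_Ico_inter_ne_top _ _ _), processed]
  · ring
  · rw [Set.disjoint_left]
    rintro s ⟨⟨_, h1⟩, _⟩ ⟨⟨h2, _⟩, _⟩
    linarith

lemma sum_processed_sub {σ : ℝ → Option ι} (S : Finset ι)
    (hm : ∀ q, MeasurableSet {t : ℝ | σ t = some q}) {a b : ℝ} (ha : 0 ≤ a) (hab : a ≤ b) :
    ∑ q ∈ S, (processed σ q b - processed σ q a) =
      volume.real {s : ℝ | s ∈ Set.Ico a b ∧ ∃ q ∈ S, σ s = some q} := by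
  have : {s : ℝ | s ∈ Set.Ico a b ∧ ∃ q ∈ S, σ s = some q} =
      ⋃ q ∈ S, {s : ℝ | s ∈ Set.Ico a b ∧ σ s = some q} := by
    ext s
    simp only [Set.mem_ofPred_eq, Set.mem_iUnion]
    tauto
  rw [this, measureReal_biUnion_finset _ _ fun q _ => volume_Ico_inter_ne_top _ _ _]
  · exact Finset.sum_congr rfl fun q _ => processed_sub (hm q) ha hab
  · intro x _ y _ hxy
    rw [Function.onFun, Set.disjoint_left]
    rintro s ⟨_, h1⟩ ⟨_, h2⟩
    exact hxy (Option.some_injective _ (h1.symm.trans h2))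
  · exact fun q _ => measurableSet_Ico.inter (hm q)

lemma sum_processed_sub_le {σ : ℝ → Option ι} (S : Finset ι)
    (hm : ∀ q, MeasurableSet {t : ℝ | σ t = some q}) {a b : ℝ} (ha : 0 ≤ a) (hab : a ≤ b) :
    ∑ q ∈ S, (processed σ q b - processed σ q a) ≤ b - a := by
  rw [sum_processed_sub S hm ha hab, ← Real.volume_real_Ico_of_le hab]
  exact measureReal_mono (fun s hs => hs.1) measure_Ico_lt_top.ne

lemma le_sum_processed_sub {σ : ℝ → Option ι} (S : Finset ι)
    (hm : ∀ q, MeasurableSet {t : ℝ | σ t = some q}) {a b : ℝ} (ha : 0 ≤ a) (hab : a ≤ b)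
    (h : ∀ s ∈ Set.Ioo a b, ∃ q ∈ S, σ s = some q) :
    b - a ≤ ∑ q ∈ S, (processed σ q b - processed σ q a) := by
  rw [sum_processed_sub S hm ha hab, ← Real.volume_real_Ioo_of_le hab]
  exact measureReal_mono (fun s hs => ⟨Set.Ioo_subset_Ico_self hs, h s hs⟩)
    (volume_Ico_inter_ne_top _ _ _)

/-! ### Comparing two schedules on a set of jobs -/

/-- The excess of the remaining volume of the jobs of `S` in `σ` over that in `τ`. -/
def excess (σ τ : ℝ → Option ι) (S : Finset ι) (t : ℝ) : ℝ :=
  ∑ q ∈ S, (processed τ q t - processed σ q t)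

lemma continuous_excess (σ τ : ℝ → Option ι) (S : Finset ι) : Continuous (excess σ τ S) :=
  continuous_finsetSum _ fun q _ => (continuous_processed τ q).sub (continuous_processed σ q)

lemma excess_zero (σ τ : ℝ → Option ι) (S : Finset ι) : excess σ τ S 0 = 0 := by
  simp [excess, processed_of_nonpos]

lemma excess_le_excess {σ τ : ℝ → Option ι} (S : Finset ι)
    (hσ : ∀ q, MeasurableSet {t : ℝ | σ t = some q})
    (hτ : ∀ q, MeasurableSet {t : ℝ | τ t = some q}) {a b : ℝ} (ha : 0 ≤ a) (hab : a ≤ b)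
    (h : ∀ s ∈ Set.Ioo a b, ∃ q ∈ S, σ s = some q) :
    excess σ τ S b ≤ excess σ τ S a := by
  have h1 := sum_processed_sub_le S hτ ha hab
  have h2 := le_sum_processed_sub S hσ ha hab h
  simp only [excess, Finset.sum_sub_distrib] at *
  linarith

/-- Unless `σ` works on `S` during all of `[0, t)`, there is a last time `u ≤ t` before which it
did not, in the sense of closures. -/
lemma excess_nonpos_or_exists_closure {σ τ : ℝ → Option ι} (S : Finset ι)
    (hσ : ∀ q, MeasurableSet {t : ℝ | σ t = some q})
    (hτ : ∀ q, MeasurableSet {t : ℝ | τ t = some q}) {t : ℝ} (ht : 0 ≤ t) :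
    excess σ τ S t ≤ 0 ∨ ∃ u ∈ closure {s : ℝ | s ∈ Set.Ico 0 t ∧ ∀ q ∈ S, σ s ≠ some q},
      excess σ τ S t ≤ excess σ τ S u ∧ ∀ q ∉ S, processed σ q t = processed σ q u := by
  set T := {s : ℝ | s ∈ Set.Ico 0 t ∧ ∀ q ∈ S, σ s ≠ some q} with hT
  rcases T.eq_empty_or_nonempty with h | h
  · left
    rw [← excess_zero σ τ S]
    refine excess_le_excess S hσ hτ le_rfl ht fun s hs => ?_
    by_contra! hc
    exact (h ▸ (⟨⟨hs.1.le, hs.2⟩, hc⟩ : s ∈ T) : s ∈ (∅ : Set ℝ))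
  · right
    have hb : BddAbove T := ⟨t, fun s hs => hs.1.2.le⟩
    have hu : sSup T ≤ t := csSup_le h fun s hs => hs.1.2.le
    have hu0 : 0 ≤ sSup T := by
      obtain ⟨s, hs⟩ := h
      exact hs.1.1.trans (le_csSup hb hs)
    have key : ∀ s ∈ Set.Ioo (sSup T) t, ∃ q ∈ S, σ s = some q := by
      intro s hs
      by_contra! hc
      exact absurd (le_csSup hb (⟨⟨hu0.trans hs.1.le, hs.2⟩, hc⟩ : s ∈ T)) (not_le.2 hs.1)
    refine ⟨sSup T, csSup_mem_closure h hb, excess_le_excess S hσ hτ hu0 hu key, fun q hq => ?_⟩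
    refine processed_eq_of_forall_ne σ q hu fun s hs hsq => ?_
    obtain ⟨x, hx, hsx⟩ := key s hs
    exact hq (Option.some_injective _ (hsx.symm.trans hsq) ▸ hx)

/-! ### Pending jobs and their volume -/

namespace Instance

variable (I : Instance ι)

variable {I} in
-- By continuity, the processed amount would first have to equal the processing time; from then on
-- the job is no longer pending and cannot be processed.
lemma IsSchedule.processed_le {σ : ℝ → Option ι} (h : I.IsSchedule σ) (q : ι) (t : ℝ) :
    processed σ q t ≤ I.processingTime q := by
  by_contra! hc
  have ht : 0 ≤ t := by
    by_contra! h0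
    rw [processed_of_nonpos σ q h0.le] at hc
    exact (I.processingTime_pos q).not_gt hc
  obtain ⟨s, hs, hsq⟩ := intermediate_value_Icc ht (continuous_processed σ q).continuousOn
    (show I.processingTime q ∈ Set.Icc (processed σ q 0) (processed σ q t) from
      ⟨by rw [processed_of_nonpos σ q le_rfl]; exact (I.processingTime_pos q).le, hc.le⟩)
  have : processed σ q t = processed σ q s := by
    refine processed_eq_of_forall_ne σ q hs.2 fun u hu huq => ?_
    have h1 := (h.pending u q huq).2
    have h2 := processed_mono σ q hu.1.le
    rw [remaining] at h1
    linarith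
  linarith

variable {I} in
lemma IsSchedule.remaining_nonneg {σ : ℝ → Option ι} (h : I.IsSchedule σ) (q : ι) (t : ℝ) :
    0 ≤ I.remaining σ q t := sub_nonneg.2 (h.processed_le q t)

lemma remaining_le (σ : ℝ → Option ι) (q : ι) (t : ℝ) :
    I.remaining σ q t ≤ I.processingTime q := sub_le_self _ (processed_nonneg σ q t)

variable {I} in
lemma IsSchedule.processed_of_lt_release {σ : ℝ → Option ι} (h : I.IsSchedule σ) {q : ι} {t : ℝ}
    (ht : t ≤ I.release q) : processed σ q t = 0 := by
  rcases le_total t 0 with h0 | h0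
  · exact processed_of_nonpos σ q h0
  rw [processed_eq_of_forall_ne σ q h0 fun s hs hsq => ?_, processed_of_nonpos σ q le_rfl]
  exact absurd (h.pending s q hsq).1 (not_le.2 (hs.2.trans_le ht))

variable {I} in
lemma IsSchedule.remaining_eq_zero {σ : ℝ → Option ι} (h : I.IsSchedule σ) {q : ι} {t : ℝ}
    (hr : I.release q ≤ t) (hp : ¬ I.IsPending σ t q) : I.remaining σ q t = 0 :=
  le_antisymm (not_lt.1 fun h' => hp ⟨hr, h'⟩) (h.remaining_nonneg q t)

open Classical in
/-- The remaining volume of a job if it is pending, and `0` otherwise. -/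
def pendingVolume (σ : ℝ → Option ι) (t : ℝ) (q : ι) : ℝ :=
  if I.IsPending σ t q then I.remaining σ q t else 0

lemma pendingVolume_of_not {σ : ℝ → Option ι} {t : ℝ} {q : ι} (h : ¬ I.IsPending σ t q) :
    I.pendingVolume σ t q = 0 := if_neg h

lemma pendingVolume_of {σ : ℝ → Option ι} {t : ℝ} {q : ι} (h : I.IsPending σ t q) :
    I.pendingVolume σ t q = I.remaining σ q t := if_pos h

lemma pendingVolume_nonneg (σ : ℝ → Option ι) (t : ℝ) (q : ι) : 0 ≤ I.pendingVolume σ t q := by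
  by_cases h : I.IsPending σ t q
  · rw [I.pendingVolume_of h]; exact h.2.le
  · rw [I.pendingVolume_of_not h]

variable {I} in
lemma IsSchedule.processed_sub_processed {σ τ : ℝ → Option ι} (hσ : I.IsSchedule σ)
    (hτ : I.IsSchedule τ) (q : ι) (t : ℝ) :
    processed τ q t - processed σ q t = I.pendingVolume σ t q - I.pendingVolume τ t q := by
  rcases lt_or_ge t (I.release q) with h | h
  · rw [hσ.processed_of_lt_release h.le, hτ.processed_of_lt_release h.le,
      I.pendingVolume_of_not fun h' => absurd h'.1 (not_le.2 h),
      I.pendingVolume_of_not fun h' => absurd h'.1 (not_le.2 h)]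
  · have key : ∀ {ρ : ℝ → Option ι}, I.IsSchedule ρ →
        I.pendingVolume ρ t q = I.processingTime q - processed ρ q t := by
      intro ρ hρ
      by_cases hp : I.IsPending ρ t q
      · exact I.pendingVolume_of hp
      · rw [I.pendingVolume_of_not hp, ← hρ.remaining_eq_zero h hp, remaining]
    rw [key hσ, key hτ]
    ring

variable {I} in
-- Pending volumes jump at releases, but equally in both schedules, so the difference is the
-- continuous function `excess`. Continuity is what allows passing to closures later.
lemma IsSchedule.excess_eq {σ τ : ℝ → Option ι} (hσ : I.IsSchedule σ) (hτ : I.IsSchedule τ)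
    (S : Finset ι) (t : ℝ) :
    excess σ τ S t = ∑ q ∈ S, I.pendingVolume σ t q - ∑ q ∈ S, I.pendingVolume τ t q := by
  rw [excess, ← Finset.sum_sub_distrib]
  exact Finset.sum_congr rfl fun q _ => hσ.processed_sub_processed hτ q t

lemma mem_pendingJobs [Fintype ι] {σ : ℝ → Option ι} {t : ℝ} {q : ι} :
    q ∈ I.pendingJobs σ t ↔ I.IsPending σ t q := by
  simp [pendingJobs]

end Instance

/-! ### Geometric sums and rounding -/

/-- Distinct exponents bounded by `m` give at most a geometric series of ratio 1/2. Used with base λ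
over weight classes and base 2 over density classes. -/
lemma sum_zpow_le_two_mul {S : Finset ι} {f : ι → ℤ} (hf : Set.InjOn f S) {b : ℝ} (hb : 2 ≤ b)
    {m : ℤ} (hm : ∀ x ∈ S, f x ≤ m) : ∑ x ∈ S, b ^ f x ≤ 2 * b ^ m := by
  classical
  have hb0 : 0 < b := by linarith
  have h1 : ∀ x ∈ S, b ^ f x ≤ b ^ m * (1 / 2 : ℝ) ^ (m - f x).toNat := by
    intro x hx
    have : b ^ f x = b ^ m * (1 / b) ^ (m - f x).toNat := by
      rw [← zpow_natCast, Int.toNat_of_nonneg (sub_nonneg.2 (hm x hx)), one_div, inv_zpow,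
        ← zpow_neg, ← zpow_add₀ hb0.ne']
      congr 1
      ring
    rw [this]
    gcongr
  have hinj : Set.InjOn (fun x => (m - f x).toNat) S := by
    intro x hx y hy hxy
    have h2 := hm x hx
    have h3 := hm y hy
    simp only at hxy
    exact hf hx hy (by omega)
  calc ∑ x ∈ S, b ^ f x ≤ ∑ x ∈ S, b ^ m * (1 / 2 : ℝ) ^ (m - f x).toNat := Finset.sum_le_sum h1
    _ = b ^ m * ∑ n ∈ S.image (fun x => (m - f x).toNat), (1 / 2 : ℝ) ^ n := by
      rw [Finset.sum_image hinj, Finset.mul_sum]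
    _ ≤ b ^ m * 2 := by
      gcongr
      exact (summable_geometric_two.sum_le_tsum _ fun n _ => by positivity).trans_eq
        tsum_geometric_two
    _ = 2 * b ^ m := mul_comm _ _

section Classes

variable {μ : ℝ}

lemma two_le_base (hμ : 1 ≤ μ) : 2 ≤ base μ := by rw [base]; linarith

lemma base_pos (hμ : 1 ≤ μ) : 0 < base μ := by linarith [two_le_base hμ]

lemma roundedWeight_pos (hμ : 1 ≤ μ) (w : ℝ) : 0 < roundedWeight μ w :=
  zpow_pos (base_pos hμ) _

lemma le_roundedWeight (hμ : 1 ≤ μ) {w : ℝ} (hw : 0 < w) : w ≤ roundedWeight μ w := by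
  have hb := two_le_base hμ
  rw [roundedWeight, ← Real.rpow_intCast, ← Real.logb_le_iff_le_rpow (by linarith) hw]
  exact Int.le_ceil _

lemma roundedWeight_le (hμ : 1 ≤ μ) {w : ℝ} (hw : 0 < w) : roundedWeight μ w ≤ base μ * w := by
  have hb := two_le_base hμ
  have hb0 := base_pos hμ
  rw [roundedWeight, ← Real.rpow_intCast, ← Real.le_logb_iff_rpow_le (by linarith) (by positivity),
    Real.logb_mul hb0.ne' hw.ne', Real.logb_self_eq_one (by linarith), add_comm]
  exact (Int.ceil_lt_add_one _).le

lemma two_zpow_eiClass_le (hμ : 1 ≤ μ) {w p : ℝ} (hp : 0 < p) :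
    2 ^ eiClass μ w p * roundedWeight μ w ≤ p := by
  have h0 := roundedWeight_pos hμ w
  rw [← le_div_iff₀ h0, ← Real.rpow_intCast,
    ← Real.le_logb_iff_rpow_le (by norm_num) (by positivity)]
  exact Int.floor_le _

lemma le_two_zpow_eiClass (hμ : 1 ≤ μ) {w p : ℝ} (hp : 0 < p) :
    p ≤ 2 * 2 ^ eiClass μ w p * roundedWeight μ w := by
  have h0 := roundedWeight_pos hμ w
  have h1 : (2 : ℝ) * 2 ^ eiClass μ w p = 2 ^ (((eiClass μ w p : ℤ) : ℝ) + 1) := by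
    rw [Real.rpow_add_one (by norm_num), Real.rpow_intCast, mul_comm]
  rw [← div_le_iff₀ h0, h1, ← Real.logb_le_iff_le_rpow (by norm_num) (by positivity)]
  exact (Int.lt_floor_add_one _).le

end Classes

/-! ### Weight versus volume within density classes -/

namespace Instance

variable (I : Instance ι)

/-- The weight class of a job of the input. -/
abbrev wc (μ : ℝ) (q : ι) : ℤ := weightClass μ (I.weight q)

/-- The estimated inverse density class of a job of the input. -/
abbrev idc (μ : ℝ) (q : ι) : ℤ := eiClass μ (I.weight q) (I.prediction q)

/-- The rounded weight of a job of the input. -/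
abbrev rounded (μ : ℝ) (q : ι) : ℝ := roundedWeight μ (I.weight q)

variable {I} {μ : ℝ}

lemma HasDistortion.le_processingTime (h : I.HasDistortion μ) (hμ : 1 ≤ μ) (q : ι) :
    2 ^ I.idc μ q * I.rounded μ q ≤ I.processingTime q :=
  (two_zpow_eiClass_le hμ (I.prediction_pos q)).trans (h q).1

lemma HasDistortion.processingTime_le (h : I.HasDistortion μ) (hμ : 1 ≤ μ) (q : ι) :
    I.processingTime q ≤ 2 * μ * 2 ^ I.idc μ q * I.rounded μ q := by
  have := le_two_zpow_eiClass hμ (w := I.weight q) (I.prediction_pos q)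
  calc I.processingTime q ≤ μ * I.prediction q := (h q).2.le
    _ ≤ μ * (2 * 2 ^ I.idc μ q * I.rounded μ q) := by gcongr
    _ = _ := by ring

/-- Class `c` contributes volume at most `2 * μ * 2 ^ c * X`; the geometric sum over `c ≤ k` doubles
the top term. -/
lemma HasDistortion.sum_processingTime_le (h : I.HasDistortion μ) (hμ : 1 ≤ μ) (P : Finset ι)
    (k : ℤ) {X : ℝ} (hX : 0 ≤ X)
    (hP : ∀ c ≤ k, ∑ x ∈ P with I.idc μ x = c, I.rounded μ x ≤ X) :
    ∑ x ∈ P with I.idc μ x ≤ k, I.processingTime x ≤ 4 * μ * 2 ^ k * X := by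
  classical
  set Q := P.filter fun x => I.idc μ x ≤ k with hQ
  have h1 : ∑ x ∈ Q, I.processingTime x =
      ∑ c ∈ Q.image (I.idc μ), ∑ x ∈ Q with I.idc μ x = c, I.processingTime x :=
    (Finset.sum_fiberwise_of_maps_to (fun x hx => Finset.mem_image_of_mem _ hx) _).symm
  have h2 : ∀ c ∈ Q.image (I.idc μ), ∑ x ∈ Q with I.idc μ x = c, I.processingTime x ≤
      2 * μ * X * 2 ^ c := by
    intro c hc
    have hck : c ≤ k := by
      obtain ⟨x, hx, rfl⟩ := Finset.mem_image.1 hc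
      exact (Finset.mem_filter.1 hx).2
    calc ∑ x ∈ Q with I.idc μ x = c, I.processingTime x
        ≤ ∑ x ∈ Q with I.idc μ x = c, 2 * μ * 2 ^ c * I.rounded μ x := by
          refine Finset.sum_le_sum fun x hx => ?_
          have := h.processingTime_le hμ x
          rwa [(Finset.mem_filter.1 hx).2] at this
      _ = 2 * μ * 2 ^ c * ∑ x ∈ Q with I.idc μ x = c, I.rounded μ x := by rw [Finset.mul_sum]
      _ ≤ 2 * μ * 2 ^ c * ∑ x ∈ P with I.idc μ x = c, I.rounded μ x := by
          gcongr
          · exact fun x _ _ => (roundedWeight_pos hμ _).le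
          · exact Finset.filter_subset _ _
      _ ≤ 2 * μ * 2 ^ c * X := by gcongr; exact hP c hck
      _ = _ := by ring
  rw [h1]
  refine (Finset.sum_le_sum h2).trans ?_
  rw [← Finset.mul_sum]
  have h3 : ∑ c ∈ Q.image (I.idc μ), (2 : ℝ) ^ c ≤ 2 * 2 ^ k := by
    refine sum_zpow_le_two_mul (f := id) (Set.injOn_id _) le_rfl fun c hc => ?_
    obtain ⟨x, hx, rfl⟩ := Finset.mem_image.1 hc
    exact (Finset.mem_filter.1 hx).2
  calc 2 * μ * X * ∑ c ∈ Q.image (I.idc μ), (2 : ℝ) ^ c ≤ 2 * μ * X * (2 * 2 ^ k) := by gcongr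
    _ = _ := by ring

/-- The volume of the pending jobs of class at most `k` is bounded by their weight. -/
lemma HasDistortion.sum_pendingVolume_le [Fintype ι] (h : I.HasDistortion μ) (hμ : 1 ≤ μ)
    (τ : ℝ → Option ι) (t : ℝ) (k : ℤ) {S : Finset ι}
    (hS : ∀ x ∈ S, I.IsPending τ t x → I.idc μ x ≤ k) :
    ∑ x ∈ S, I.pendingVolume τ t x ≤ 2 * μ * 2 ^ k * ∑ x ∈ I.pendingJobs τ t, I.rounded μ x := by
  classical
  have h1 : ∑ x ∈ S, I.pendingVolume τ t x =
      ∑ x ∈ S with I.IsPending τ t x, I.pendingVolume τ t x :=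
    (Finset.sum_filter_of_ne fun x _ hx => not_imp_comm.1 I.pendingVolume_of_not hx).symm
  rw [h1, Finset.mul_sum]
  calc ∑ x ∈ S with I.IsPending τ t x, I.pendingVolume τ t x
      ≤ ∑ x ∈ S with I.IsPending τ t x, 2 * μ * 2 ^ k * I.rounded μ x := by
        refine Finset.sum_le_sum fun x hx => ?_
        obtain ⟨hxS, hx⟩ := Finset.mem_filter.1 hx
        rw [I.pendingVolume_of hx]
        refine (I.remaining_le τ x t).trans ((h.processingTime_le hμ x).trans ?_)
        have := (roundedWeight_pos hμ (I.weight x)).le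
        gcongr
        · norm_num
        · exact hS x hxS hx
    _ ≤ _ := by
        refine Finset.sum_le_sum_of_subset_of_nonneg (fun x hx => ?_) fun x _ _ => ?_
        · exact I.mem_pendingJobs.2 (Finset.mem_filter.1 hx).2
        · have := (roundedWeight_pos hμ (I.weight x)).le
          positivity

end Instance

/-- A single pending job of weight class at least `i` would already exceed the whole weight allowed
by `hi`. -/
lemma wc_lt_of_sum_rounded_lt [Fintype ι] {I : Instance ι} {μ : ℝ} (hμ : 1 ≤ μ)
    {τ : ℝ → Option ι} {t : ℝ} {i : ℤ}
    (hi : 4 * μ * ∑ x ∈ I.pendingJobs τ t, I.rounded μ x < base μ ^ i) {x : ι}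
    (hx : I.IsPending τ t x) : I.wc μ x < i := by
  have hrp : ∀ x, 0 < I.rounded μ x := fun x => roundedWeight_pos hμ _
  by_contra! hc
  have h1 : I.rounded μ x ≤ ∑ x ∈ I.pendingJobs τ t, I.rounded μ x :=
    Finset.single_le_sum (f := I.rounded μ) (fun y _ => (hrp y).le) (I.mem_pendingJobs.2 hx)
  have h2 : base μ ^ i ≤ I.rounded μ x :=
    zpow_le_zpow_right₀ (by linarith [two_le_base hμ]) hc
  nlinarith [hrp x]

/-! ### The rule and its runs -/

lemma weightedRule_nonempty {μ : ℝ} (hμ : 1 ≤ μ) (weight prediction : ι → ℝ) {alive : Finset ι}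
    (h : alive.Nonempty) (partialJobs : Set ι) :
    (weightedRule μ ι weight prediction alive partialJobs).Nonempty := by
  classical
  have hne : ∀ P : Finset ι, P.Nonempty → ∃ i : ℤ,
      IsGreatest {k | ∃ x ∈ P, weightClass μ (weight x) = k} i := by
    intro P hP
    obtain ⟨x, hx, hmax⟩ := P.exists_max_image (fun x => weightClass μ (weight x)) hP
    refine ⟨_, ⟨x, hx, rfl⟩, ?_⟩
    rintro k ⟨y, hy, rfl⟩
    exact hmax y hy
  obtain ⟨i, hi⟩ := hne alive h
  set s : ℤ → ℝ := fun k => ∑ x ∈ alive.filter (fun x => eiClass μ (weight x) (prediction x) = k),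
    roundedWeight μ (weight x) with hs
  have hpos : ∀ k, base μ ^ i ≤ s k → ∃ x ∈ alive, eiClass μ (weight x) (prediction x) = k := by
    intro k hk
    by_contra! hc
    have : s k = 0 := by
      rw [hs]
      refine Finset.sum_eq_zero fun x hx => ?_
      exact absurd (Finset.mem_filter.1 hx).2 (hc x (Finset.mem_filter.1 hx).1)
    rw [this] at hk
    exact absurd (zpow_pos (base_pos hμ) i) (not_lt.2 hk)
  obtain ⟨j, hj⟩ : ∃ j : ℤ, IsLeast {k | base μ ^ i ≤ s k} j := by
    have hfin : {k | base μ ^ i ≤ s k}.Finite := by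
      refine (alive.image fun x => eiClass μ (weight x) (prediction x)).finite_toSet.subset ?_
      intro k hk
      obtain ⟨x, hx, rfl⟩ := hpos k hk
      exact Finset.mem_image_of_mem _ hx
    have hnon : {k | base μ ^ i ≤ s k}.Nonempty := by
      -- A job of the largest weight class reaches the threshold on its own, so its density class
      -- qualifies.
      obtain ⟨x, hx, hxi⟩ := hi.1
      refine ⟨eiClass μ (weight x) (prediction x), ?_⟩
      show base μ ^ i ≤ s _
      rw [← hxi]
      exact Finset.single_le_sum (f := fun x => roundedWeight μ (weight x))
        (fun y _ => (roundedWeight_pos hμ _).le) (Finset.mem_filter.2 ⟨hx, rfl⟩)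
    obtain ⟨j, hj, hmin⟩ := Set.exists_min_image _ id hfin hnon
    exact ⟨j, hj, fun k hk => hmin k hk⟩
  obtain ⟨i', hi'⟩ := hne (alive.filter fun x => eiClass μ (weight x) (prediction x) = j) (by
    obtain ⟨x, hx, hxj⟩ := hpos j hj.1
    exact ⟨x, Finset.mem_filter.2 ⟨hx, hxj⟩⟩)
  have hi'' : IsGreatest {k | ∃ x ∈ alive, eiClass μ (weight x) (prediction x) = j ∧
      weightClass μ (weight x) = k} i' := by
    convert hi' using 1
    ext k
    simp [and_assoc]
  by_cases hp : ∃ x ∈ alive, weightClass μ (weight x) = i' ∧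
      eiClass μ (weight x) (prediction x) = j ∧ x ∈ partialJobs
  · obtain ⟨x, hx, h1, h2, h3⟩ := hp
    exact ⟨x, i, j, i', hi, hj, hi'', ⟨hx, h1, h2⟩, fun _ => h3⟩
  · obtain ⟨x, hx, h2, h1⟩ := hi''.1
    exact ⟨x, i, j, i', hi, hj, hi'', ⟨hx, h1, h2⟩, fun h => absurd h hp⟩

lemma mem_alive_of_mem_weightedRule {μ : ℝ} {weight prediction : ι → ℝ} {alive : Finset ι}
    {partialJobs : Set ι} {q : ι}
    (h : q ∈ weightedRule μ ι weight prediction alive partialJobs) : q ∈ alive := by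
  obtain ⟨_, _, _, _, _, _, hq, _⟩ := h
  exact hq.1

namespace IsRun

variable [Fintype ι] {I : Instance ι} {σ : ℝ → Option ι} {R : Rule} {μ : ℝ}

/-- A job that has been processed has a first time of processing. -/
lemma exists_first (h : IsRun R I σ) {q : ι} {t : ℝ} (hq : 0 < processed σ q t) :
    ∃ s, 0 ≤ s ∧ s < t ∧ σ s = some q ∧ processed σ q s = 0 ∧
      ∀ u, s < u → 0 < processed σ q u := by
  set T := {s : ℝ | s ∈ Set.Ico 0 t ∧ σ s = some q} with hT
  have hne : T.Nonempty := by
    by_contra hc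
    rw [Set.not_nonempty_iff_eq_empty] at hc
    rw [processed, ← hT, hc, measureReal_empty] at hq
    exact lt_irrefl _ hq
  have hb : BddBelow T := ⟨0, fun s hs => hs.1.1⟩
  have h0 : 0 ≤ sInf T := le_csInf hne fun s hs => hs.1.1
  -- Right constancy makes the infimum itself a time at which `q` is processed, and keeps `q`
  -- running for a positive time afterwards.
  have hev := h.rightConstant _ h0
  obtain ⟨v, hv, hvs⟩ := (mem_nhdsGE_iff_exists_Ico_subset' (lt_add_one (sInf T))).1 hev
  obtain ⟨s, hs, hsv⟩ := exists_lt_of_csInf_lt hne hv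
  have hσ : σ (sInf T) = some q := (hvs ⟨csInf_le hb hs, hsv⟩).symm.trans hs.2
  refine ⟨sInf T, h0, (csInf_le hb hs).trans_lt hs.1.2, hσ, ?_, fun u hu => ?_⟩
  · rw [processed_eq_of_forall_ne σ q h0, processed_of_nonpos σ q le_rfl]
    intro u hu huq
    exact absurd (csInf_le hb (⟨⟨hu.1.le, (hu.2.trans_le (csInf_le hb hs)).trans hs.1.2⟩, huq⟩ :
      u ∈ T)) (not_le.2 hu.2)
  · have h1 : sInf T < min u v := lt_min hu hv
    have h2 := processed_eq_add_of_forall_eq σ q h0 h1.le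
      fun s hs => (hvs ⟨hs.1, hs.2.trans_le (min_le_right _ _)⟩).trans hσ
    have h3 := processed_mono σ q (min_le_left u v)
    have h4 := processed_nonneg σ q (sInf T)
    linarith

/-- At any time there is at most one pending partial job of given weight class and class. -/
lemma eq_of_partial (h : IsRun (weightedRule μ) I σ) {x y : ι} {t : ℝ}
    (hx : I.IsPending σ t x) (hy : I.IsPending σ t y) (hx0 : 0 < processed σ x t)
    (hy0 : 0 < processed σ y t) (hw : I.wc μ x = I.wc μ y) (hd : I.idc μ x = I.idc μ y) :
    x = y := by
  obtain ⟨a, ha0, hat, hax, hxa, hxa'⟩ := h.exists_first hx0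
  obtain ⟨b, hb0, hbt, hby, hyb, hyb'⟩ := h.exists_first hy0
  -- If `x` started before `y`, then at the start of `y` the job `x` was pending and partial in the
  -- same classes, so the rule could not have opened `y`.
  have key : ∀ {x y : ι} {a b : ℝ}, I.IsPending σ t x → 0 ≤ b → b < t → σ a = some x →
      (∀ u, a < u → 0 < processed σ x u) → σ b = some y → processed σ y b = 0 →
      I.wc μ x = I.wc μ y → I.idc μ x = I.idc μ y → ¬ a < b := by
    intro x y a b hx hb0 hbt hax hxa' hby hyb hw hd hab
    have hyp := I.mem_pendingJobs.2 (h.schedule.pending b y hby)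
    have hxp : x ∈ I.pendingJobs σ b := by
      refine I.mem_pendingJobs.2 ⟨((h.schedule.pending a x hax).1).trans hab.le, ?_⟩
      have h1 := hx.2
      have h2 := processed_mono σ x hbt.le
      rw [Instance.remaining] at *
      linarith
    obtain ⟨q, ⟨_, j, i', _, _, _, ⟨_, hq1, hq2⟩, hq3⟩, hσq⟩ := h.follows b hb0 ⟨y, hyp⟩
    obtain rfl : q = y := Option.some_injective _ (hσq.symm.trans hby)
    have : 0 < processed σ q b := hq3 ⟨x, hxp, hw.trans hq1, hd.trans hq2, hxa' b hab⟩
    exact this.ne' hyb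
  rcases lt_trichotomy a b with hab | rfl | hab
  · exact absurd hab (key hx hb0 hbt hax hxa' hby hyb hw hd)
  · exact Option.some_injective _ (hax.symm.trans hby)
  · exact absurd hab (key hy ha0 hat hby hyb' hax hxa hw.symm hd.symm)

/-- The weight of the pending jobs of a class is bounded by their volume, up to the weight of the
partial jobs. -/
lemma sum_rounded_le (h : IsRun (weightedRule μ) I σ) (hI : I.HasDistortion μ) (hμ : 1 ≤ μ)
    (t : ℝ) (k m : ℤ) (hm : ∀ x, I.IsPending σ t x → I.idc μ x = k → I.wc μ x ≤ m) :
    2 ^ k * ∑ x ∈ I.pendingJobs σ t with I.idc μ x = k, I.rounded μ x ≤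
      ∑ x ∈ I.pendingJobs σ t with I.idc μ x = k, I.pendingVolume σ t x +
        2 ^ k * (2 * base μ ^ m) := by
  classical
  set Q := (I.pendingJobs σ t).filter fun x => I.idc μ x = k with hQ
  have hmem : ∀ x ∈ Q, I.IsPending σ t x ∧ I.idc μ x = k := fun x hx =>
    ⟨I.mem_pendingJobs.1 (Finset.mem_filter.1 hx).1, (Finset.mem_filter.1 hx).2⟩
  -- Partial jobs of one density class have distinct weight classes, hence a geometric sum.
  have hpart : ∑ x ∈ Q with 0 < processed σ x t, I.rounded μ x ≤ 2 * base μ ^ m := by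
    refine sum_zpow_le_two_mul (f := I.wc μ) ?_ (two_le_base hμ) fun x hx => ?_
    · intro x hx y hy hxy
      obtain ⟨hx1, hx2⟩ := Finset.mem_filter.1 hx
      obtain ⟨hy1, hy2⟩ := Finset.mem_filter.1 hy
      exact h.eq_of_partial (hmem x hx1).1 (hmem y hy1).1 hx2 hy2 hxy
        ((hmem x hx1).2.trans (hmem y hy1).2.symm)
    · have := hmem x (Finset.mem_filter.1 hx).1
      exact hm x this.1 this.2
  -- Untouched jobs still have their full volume.
  have hfull : 2 ^ k * ∑ x ∈ Q with ¬ 0 < processed σ x t, I.rounded μ x ≤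
      ∑ x ∈ Q, I.pendingVolume σ t x := by
    rw [Finset.mul_sum]
    calc ∑ x ∈ Q with ¬ 0 < processed σ x t, 2 ^ k * I.rounded μ x
        ≤ ∑ x ∈ Q with ¬ 0 < processed σ x t, I.pendingVolume σ t x := by
          refine Finset.sum_le_sum fun x hx => ?_
          obtain ⟨hx1, hx2⟩ := Finset.mem_filter.1 hx
          have h0 : processed σ x t = 0 := le_antisymm (not_lt.1 hx2) (processed_nonneg σ x t)
          rw [I.pendingVolume_of (hmem x hx1).1, Instance.remaining, h0, sub_zero]
          have := hI.le_processingTime hμ x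
          rwa [(hmem x hx1).2] at this
      _ ≤ _ := Finset.sum_le_sum_of_subset_of_nonneg (Finset.filter_subset _ _)
          fun x _ _ => I.pendingVolume_nonneg σ t x
  rw [← Finset.sum_filter_add_sum_filter_not Q (fun x => 0 < processed σ x t), mul_add, add_comm]
  gcongr

open Classical in
/-- The volume bound behind the competitive analysis: if the pending weight of `τ` is small
compared to `λ ^ i`, then `σ` is hardly behind `τ` on the jobs of weight class at least `i` or
class at most `j`. -/
lemma excess_le (h : IsRun (weightedRule μ) I σ) (hI : I.HasDistortion μ) (hμ : 1 ≤ μ)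
    {τ : ℝ → Option ι} (hτ : I.IsSchedule τ) {t : ℝ} (ht : 0 ≤ t) {i : ℤ}
    (hi : 4 * μ * ∑ x ∈ I.pendingJobs τ t, I.rounded μ x < base μ ^ i) (j : ℤ) :
    excess σ τ (Finset.univ.filter fun x => i ≤ I.wc μ x ∨ I.idc μ x ≤ j) t ≤
      4 * μ * 2 ^ j * base μ ^ (i - 1) := by
  have hb := base_pos hμ
  set W := ∑ x ∈ I.pendingJobs τ t, I.rounded μ x with hW
  set L := base μ ^ (i - 1) with hL
  have hL0 : 0 < L := zpow_pos hb _
  have hbi : base μ ^ i = base μ * L := by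
    rw [hL, ← zpow_one_add₀ hb.ne']; congr 1; ring
  have hrp : ∀ x, 0 < I.rounded μ x := fun x => roundedWeight_pos hμ _
  have hτi : ∀ x, I.IsPending τ t x → I.wc μ x < i := fun x hx =>
    wc_lt_of_sum_rounded_lt hμ hi hx
  -- the volume at time `s` of the light jobs of class `k` that are released by time `t`
  set U : ℤ → ℝ → ℝ := fun k s =>
    ∑ x with I.wc μ x < i ∧ I.idc μ x = k ∧ I.release x ≤ t, I.remaining σ x s with hU
  -- The release condition refers to the fixed time `t`, not to `s`, so the index set does not vary
  -- and `U k` is continuous; jobs released after `s` only increase it.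
  have hUc : ∀ k, Continuous (U k) := fun k =>
    continuous_finsetSum _ fun x _ => continuous_const.sub (continuous_processed σ x)
  have hUvol : ∀ k s, s ≤ t → (∀ x, I.IsPending σ s x → I.idc μ x = k → I.wc μ x < i) →
      ∑ x ∈ I.pendingJobs σ s with I.idc μ x = k, I.pendingVolume σ s x ≤ U k s := by
    intro k s hst hk
    calc _ = ∑ x ∈ I.pendingJobs σ s with I.idc μ x = k, I.remaining σ x s := by
          refine Finset.sum_congr rfl fun x hx => ?_
          exact I.pendingVolume_of (I.mem_pendingJobs.1 (Finset.mem_filter.1 hx).1)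
      _ ≤ U k s := by
          refine Finset.sum_le_sum_of_subset_of_nonneg (fun x hx => ?_)
            fun x _ _ => h.schedule.remaining_nonneg x s
          obtain ⟨h1, h2⟩ := Finset.mem_filter.1 hx
          have h1 := I.mem_pendingJobs.1 h1
          exact Finset.mem_filter.2 ⟨Finset.mem_univ _, hk x h1 h2, h2, h1.1.trans hst⟩
  -- The threshold weight λ^i of a selected class, less the at most 2λ^(i-1) carried by its light
  -- partial jobs.
  set θ := base μ * L - 2 * L with hθ
  have hμ0 : 0 < μ := by linarith
  -- going back to the last time at which none of the jobs in question is processed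
  have back : ∀ k : ℤ, (∀ k', k < k' → U k' t < 2 ^ k' * θ) →
      excess σ τ (Finset.univ.filter fun x => i ≤ I.wc μ x ∨ I.idc μ x ≤ k) t ≤
      4 * μ * 2 ^ k * L := by
    intro k hk
    set B := Finset.univ.filter fun x => i ≤ I.wc μ x ∨ I.idc μ x ≤ k with hB
    have hmemB : ∀ x, x ∈ B ↔ i ≤ I.wc μ x ∨ I.idc μ x ≤ k := by simp [hB]
    have hc0 : 0 ≤ 4 * μ * 2 ^ k * L := by positivity
    rcases excess_nonpos_or_exists_closure B h.schedule.measurable hτ.measurable ht with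
      h0 | ⟨u, hu, hut, hproc⟩
    · exact h0.trans hc0
    set C : Finset ℤ := (Finset.univ.image (I.idc μ)).filter fun c => k < c with hC
    have hsub : {s : ℝ | s ∈ Set.Ico 0 t ∧ ∀ q ∈ B, σ s ≠ some q} ⊆
        {s | excess σ τ B s ≤ 4 * μ * 2 ^ k * L} ∪ ⋃ c ∈ C, {s | 2 ^ c * θ ≤ U c s} := by
      rintro s ⟨⟨hs0, hst⟩, hsB⟩
      by_cases hne : (I.pendingJobs σ s).Nonempty
      swap
      · left
        show excess σ τ B s ≤ _
        refine le_trans ?_ hc0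
        rw [h.schedule.excess_eq hτ, Finset.sum_eq_zero, zero_sub, neg_nonpos]
        · exact Finset.sum_nonneg fun x _ => I.pendingVolume_nonneg τ s x
        · intro x _
          exact I.pendingVolume_of_not fun hx => hne ⟨x, I.mem_pendingJobs.2 hx⟩
      obtain ⟨q, ⟨i₀, c, i', hi₀, hc, hi', ⟨hqa, hqw, hqd⟩, -⟩, hσq⟩ := h.follows s hs0 hne
      have hqB : q ∉ B := fun hq => hsB q hq hσq
      rw [hmemB, not_or, not_le, not_le] at hqB
      have hqd' : I.idc μ q = c := hqd
      have hqw' : I.wc μ q = i' := hqw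
      rcases lt_or_ge i₀ i with hlt | hge
      -- No job of weight class at least `i` is pending, and minimality of `c > k` keeps each class
      -- up to `k` below weight `L`.
      · left
        show excess σ τ B s ≤ _
        have hi₀L : base μ ^ i₀ ≤ L :=
          zpow_le_zpow_right₀ (by linarith [two_le_base hμ]) (by omega)
        have h1 := hI.sum_processingTime_le hμ (I.pendingJobs σ s) k hL0.le fun c' hc' => by
          by_contra! hcon
          have : c ≤ c' := hc.2 (hi₀L.trans hcon.le)
          omega
        refine le_trans ?_ h1
        rw [h.schedule.excess_eq hτ]
        refine (sub_le_self _ (Finset.sum_nonneg fun x _ =>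
          I.pendingVolume_nonneg τ s x)).trans ?_
        calc ∑ x ∈ B, I.pendingVolume σ s x
            = ∑ x ∈ B with I.IsPending σ s x, I.pendingVolume σ s x := by
              exact (Finset.sum_filter_of_ne fun x _ hx =>
                not_imp_comm.1 I.pendingVolume_of_not hx).symm
          _ ≤ ∑ x ∈ B with I.IsPending σ s x, I.processingTime x := by
              refine Finset.sum_le_sum fun x hx => ?_
              rw [I.pendingVolume_of (Finset.mem_filter.1 hx).2]
              exact I.remaining_le σ x s
          _ ≤ _ := by
              refine Finset.sum_le_sum_of_subset_of_nonneg (fun x hx => ?_)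
                fun x _ _ => (I.processingTime_pos x).le
              obtain ⟨hxB, hxp⟩ := Finset.mem_filter.1 hx
              have hxp := I.mem_pendingJobs.2 hxp
              have hxw : I.wc μ x ≤ i₀ := hi₀.2 ⟨x, hxp, rfl⟩
              refine Finset.mem_filter.2 ⟨hxp, ((hmemB x).1 hxB).resolve_left ?_⟩
              omega
      -- Class `c` has weight at least λ^i although its pending jobs all have weight class below
      -- `i`, so it must hold volume at least `2 ^ c * θ`.
      · right
        have hcC : c ∈ C := by
          refine Finset.mem_filter.2 ⟨?_, by omega⟩
          rw [← hqd']
          exact Finset.mem_image_of_mem _ (Finset.mem_univ _)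
        refine Set.mem_iUnion₂.2 ⟨c, hcC, ?_⟩
        show 2 ^ c * θ ≤ U c s
        have hlight : ∀ x, I.IsPending σ s x → I.idc μ x = c → I.wc μ x ≤ i - 1 := by
          intro x hx hxc
          have : I.wc μ x ≤ i' := hi'.2 ⟨x, I.mem_pendingJobs.2 hx, hxc, rfl⟩
          omega
        have h1 := h.sum_rounded_le hI hμ s c (i - 1) hlight
        have h2 := hUvol c s hst.le fun x hx hxc => by have := hlight x hx hxc; omega
        have h3 : base μ * L ≤ ∑ x ∈ I.pendingJobs σ s with I.idc μ x = c, I.rounded μ x := by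
          rw [← hbi]
          exact (zpow_le_zpow_right₀ (by linarith [two_le_base hμ]) hge).trans hc.1
        have h4 : (2 : ℝ) ^ c * (base μ * L) ≤
            2 ^ c * ∑ x ∈ I.pendingJobs σ s with I.idc μ x = c, I.rounded μ x := by gcongr
        rw [hθ, mul_sub]
        linarith
    -- The last moment `u` is only a limit of times satisfying the dichotomy, so both alternatives
    -- must be closed conditions.
    have hclosed : IsClosed ({s | excess σ τ B s ≤ 4 * μ * 2 ^ k * L} ∪
        ⋃ c ∈ C, {s | 2 ^ c * θ ≤ U c s}) :=
      (isClosed_le (continuous_excess σ τ B) continuous_const).union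
        (C.finite_toSet.isClosed_biUnion fun c _ => isClosed_le continuous_const (hUc c))
    rcases closure_minimal hsub hclosed hu with hu | hu
    · exact hut.trans hu
    · obtain ⟨c, hcC, hcu⟩ := Set.mem_iUnion₂.1 hu
      have hkc := (Finset.mem_filter.1 hcC).2
      -- The jobs counted by `U c` lie outside `B` and are not processed between `u` and `t`, so
      -- their volume at `u` persists to `t`.
      refine absurd (hk c hkc) (not_lt.2 (le_trans hcu (le_of_eq ?_)))
      refine Finset.sum_congr rfl fun x hx => ?_
      have hx := (Finset.mem_filter.1 hx).2
      rw [Instance.remaining, Instance.remaining, hproc x]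
      rw [hmemB]
      omega
  -- reduction to classes above which all light volumes are small
  by_contra! hcon
  have hex : ∃ k', j < k' ∧ 2 ^ k' * θ ≤ U k' t := by
    by_contra! hc
    exact absurd (back j hc) (not_le.2 hcon)
  have hθ0 : 0 < θ := by
    rw [hθ, base]; nlinarith
  -- The highest class with large light volume: `back` applies to it, while its own light volume is
  -- counted in the set that `back` bounds.
  set K := (Finset.univ.image (I.idc μ)).filter fun c => 2 ^ c * θ ≤ U c t with hK
  have hKmem : ∀ c, 2 ^ c * θ ≤ U c t → c ∈ K := by
    intro c hc
    refine Finset.mem_filter.2 ⟨?_, hc⟩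
    by_contra hn
    have : U c t = 0 := by
      refine Finset.sum_eq_zero fun x hx => ?_
      refine absurd (Finset.mem_image.2 ⟨x, Finset.mem_univ _, ?_⟩) hn
      exact (Finset.mem_filter.1 hx).2.2.1
    have : 0 < (2 : ℝ) ^ c * θ := by positivity
    linarith
  have hKne : K.Nonempty := by
    obtain ⟨k', _, hk'⟩ := hex
    exact ⟨k', hKmem k' hk'⟩
  have hmax := K.max'_mem hKne
  set k := K.max' hKne with hk
  have h1 := back k fun k' hk' => by
    by_contra! hc
    exact absurd (K.le_max' k' (hKmem k' hc)) (not_le.2 hk')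
  have h2 : 2 ^ k * θ ≤ U k t := (Finset.mem_filter.1 hmax).2
  rw [h.schedule.excess_eq hτ] at h1
  have h3 : U k t ≤ ∑ x with i ≤ I.wc μ x ∨ I.idc μ x ≤ k, I.pendingVolume σ t x := by
    calc U k t = ∑ x with I.wc μ x < i ∧ I.idc μ x = k ∧ I.release x ≤ t,
          I.pendingVolume σ t x := by
          refine Finset.sum_congr rfl fun x hx => ?_
          have hx := (Finset.mem_filter.1 hx).2.2.2
          by_cases hp : I.IsPending σ t x
          · rw [I.pendingVolume_of hp]
          · rw [I.pendingVolume_of_not hp, h.schedule.remaining_eq_zero hx hp]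
      _ ≤ _ := by
          refine Finset.sum_le_sum_of_subset_of_nonneg (fun x hx => ?_)
            fun x _ _ => I.pendingVolume_nonneg σ t x
          have hx := (Finset.mem_filter.1 hx).2
          exact Finset.mem_filter.2 ⟨Finset.mem_univ _, Or.inr hx.2.1.le⟩
  have h4 := hI.sum_pendingVolume_le hμ τ t k
    (S := Finset.univ.filter fun x => i ≤ I.wc μ x ∨ I.idc μ x ≤ k) fun x hx hp =>
      ((Finset.mem_filter.1 hx).2).resolve_left (not_le.2 (hτi x hp))
  have h5 : (2 : ℝ) ^ k * θ ≤ 2 ^ k * (4 * μ * L + 2 * μ * W) := by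
    calc (2 : ℝ) ^ k * θ ≤ 4 * μ * 2 ^ k * L + 2 * μ * 2 ^ k * W := by linarith
      _ = _ := by ring
  have h6 := le_of_mul_le_mul_left h5 (by positivity)
  rw [hbi] at hi
  rw [hθ] at h6
  rw [base] at *
  -- With λ = 16μ + 6, `h6` gives (16μ + 4)`L` ≤ 4μ`L` + 2μ`W`, while `hi` gives 2μ`W` < (8μ +
  -- 3)`L`.
  nlinarith

end IsRun

/-! ### Local competitiveness -/

namespace IsRun

variable [Fintype ι] {I : Instance ι} {σ τ : ℝ → Option ι} {μ : ℝ}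

open Classical in
lemma sum_pendingVolume_le (h : IsRun (weightedRule μ) I σ) (hI : I.HasDistortion μ) (hμ : 1 ≤ μ)
    (hτ : I.IsSchedule τ) {t : ℝ} (ht : 0 ≤ t) {i : ℤ}
    (hi : 4 * μ * ∑ x ∈ I.pendingJobs τ t, I.rounded μ x < base μ ^ i) (j : ℤ) :
    ∑ x with i ≤ I.wc μ x ∨ I.idc μ x ≤ j, I.pendingVolume σ t x ≤
      2 ^ j * (4 * μ * base μ ^ (i - 1) + 2 * μ * ∑ x ∈ I.pendingJobs τ t, I.rounded μ x) := by
  have h1 := h.excess_le hI hμ hτ ht hi j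
  have h2 := hI.sum_pendingVolume_le hμ τ t j
    (S := Finset.univ.filter fun x => i ≤ I.wc μ x ∨ I.idc μ x ≤ j) fun x hx hp =>
      ((Finset.mem_filter.1 hx).2).resolve_left (not_le.2 (wc_lt_of_sum_rounded_lt hμ hi hp))
  rw [h.schedule.excess_eq hτ] at h1
  linarith

/-- Jobs of weight class at least `i` are included in the volume bound for every `j`, and that bound
tends to 0 as `j` tends to -∞. -/
lemma wc_lt (h : IsRun (weightedRule μ) I σ) (hI : I.HasDistortion μ) (hμ : 1 ≤ μ)
    (hτ : I.IsSchedule τ) {t : ℝ} (ht : 0 ≤ t) {i : ℤ}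
    (hi : 4 * μ * ∑ x ∈ I.pendingJobs τ t, I.rounded μ x < base μ ^ i) {q : ι}
    (hq : I.IsPending σ t q) : I.wc μ q < i := by
  classical
  by_contra! hc
  set c := 4 * μ * base μ ^ (i - 1) + 2 * μ * ∑ x ∈ I.pendingJobs τ t, I.rounded μ x with hcdef
  have hc0 : 0 < c := by
    have h1 : 0 < base μ ^ (i - 1) := zpow_pos (base_pos hμ) _
    have h2 : 0 ≤ ∑ x ∈ I.pendingJobs τ t, I.rounded μ x :=
      Finset.sum_nonneg fun x _ => (roundedWeight_pos hμ _).le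
    positivity
  obtain ⟨n, hn⟩ := exists_pow_lt_of_lt_one (div_pos hq.2 hc0) (by norm_num : (1 / 2 : ℝ) < 1)
  rw [lt_div_iff₀ hc0] at hn
  have h1 := h.sum_pendingVolume_le hI hμ hτ ht hi (-(n : ℤ))
  have h2 : I.remaining σ q t ≤
      ∑ x with i ≤ I.wc μ x ∨ I.idc μ x ≤ -(n : ℤ), I.pendingVolume σ t x := by
    rw [← I.pendingVolume_of hq]
    exact Finset.single_le_sum (f := I.pendingVolume σ t)
      (fun x _ => I.pendingVolume_nonneg σ t x)
      (Finset.mem_filter.2 ⟨Finset.mem_univ q, Or.inl hc⟩)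
  rw [zpow_neg, zpow_natCast, ← inv_pow, ← one_div] at h1
  linarith

open Classical in
/-- Local competitiveness with respect to the rounded weights. -/
lemma sum_rounded_pendingJobs_le (h : IsRun (weightedRule μ) I σ) (hI : I.HasDistortion μ)
    (hμ : 1 ≤ μ) (hτ : I.IsSchedule τ) {t : ℝ} (ht : 0 ≤ t) :
    ∑ x ∈ I.pendingJobs σ t, I.rounded μ x ≤
      (Finset.univ.image (I.idc μ)).card * (26 * μ ^ 2) *
        ∑ x ∈ I.pendingJobs τ t, I.rounded μ x := by
  set W := ∑ x ∈ I.pendingJobs τ t, I.rounded μ x with hW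
  have hW0 : 0 ≤ W := Finset.sum_nonneg fun x _ => (roundedWeight_pos hμ _).le
  have hb := two_le_base hμ
  rcases hW0.eq_or_lt with h0 | h0
  -- If `τ` has nothing pending, every `i` satisfies the hypothesis of `wc_lt`; taking the weight
  -- class of `x` itself is contradictory.
  · rw [← h0, mul_zero]
    refine (Finset.sum_eq_zero fun x hx => ?_).le
    refine absurd (h.wc_lt hI hμ hτ ht (i := I.wc μ x) ?_ (I.mem_pendingJobs.1 hx))
      (lt_irrefl _)
    rw [← hW, ← h0, mul_zero]
    exact zpow_pos (base_pos hμ) _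
  -- The least admissible `i` is `n + 1`; then λ^n ≤ 4μ`W` converts the error terms into multiples
  -- of `W`: 16μ² + 2μ + 8μ ≤ 26μ².
  obtain ⟨n, hn1, hn2⟩ := exists_mem_Ico_zpow (show 0 < 4 * μ * W by positivity)
    (show 1 < base μ by linarith)
  have hclass : ∀ k : ℤ, ∑ x ∈ I.pendingJobs σ t with I.idc μ x = k, I.rounded μ x ≤
      26 * μ ^ 2 * W := by
    intro k
    have h1 := h.sum_rounded_le hI hμ t k n fun x hx _ => by
      have := h.wc_lt hI hμ hτ ht hn2 hx
      omega
    have h2 := h.sum_pendingVolume_le hI hμ hτ ht hn2 k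
    rw [add_sub_cancel_right, ← hW] at h2
    have h3 : ∑ x ∈ I.pendingJobs σ t with I.idc μ x = k, I.pendingVolume σ t x ≤
        ∑ x with n + 1 ≤ I.wc μ x ∨ I.idc μ x ≤ k, I.pendingVolume σ t x := by
      refine Finset.sum_le_sum_of_subset_of_nonneg (fun x hx => ?_)
        fun x _ _ => I.pendingVolume_nonneg σ t x
      exact Finset.mem_filter.2 ⟨Finset.mem_univ _, Or.inr (Finset.mem_filter.1 hx).2.le⟩
    have h4 : (2 : ℝ) ^ k * ∑ x ∈ I.pendingJobs σ t with I.idc μ x = k, I.rounded μ x ≤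
        2 ^ k * (4 * μ * base μ ^ n + 2 * μ * W + 2 * base μ ^ n) := by
      rw [mul_add _ _ (2 * base μ ^ n)]
      linarith
    refine (le_of_mul_le_mul_left h4 (by positivity)).trans ?_
    have h5 : 4 * μ * base μ ^ n ≤ 4 * μ * (4 * μ * W) := by gcongr
    have h6 : μ * W ≤ μ ^ 2 * W := by
      rw [sq]
      gcongr
      nlinarith
    linarith
  rw [← Finset.sum_fiberwise_of_maps_to (g := I.idc μ) (t := Finset.univ.image (I.idc μ))
    (fun x _ => Finset.mem_image_of_mem _ (Finset.mem_univ x))]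
  refine (Finset.sum_le_card_nsmul _ _ _ fun k _ => hclass k).trans ?_
  rw [nsmul_eq_mul]
  exact (mul_assoc _ _ _).ge

end IsRun

/-! ### The number of density classes -/

namespace Instance

lemma density_pos (I : Instance ι) (q : ι) : 0 < I.density q :=
  div_pos (I.weight_pos q) (I.processingTime_pos q)

variable [Fintype ι] {I : Instance ι} {μ : ℝ}

lemma le_densityRatio (I : Instance ι) (x y : ι) : I.density x / I.density y ≤ I.densityRatio :=
  le_ciSup (f := fun x : ι × ι => I.density x.1 / I.density x.2)
    (Set.finite_range _).bddAbove (x, y)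

lemma one_le_densityRatio [Nonempty ι] (I : Instance ι) : 1 ≤ I.densityRatio := by
  obtain ⟨x⟩ := ‹Nonempty ι›
  have := I.le_densityRatio x x
  rwa [div_self (I.density_pos x).ne'] at this

/-- Replacing processing time over weight by prediction over rounded weight decreases it by a factor
of at most μλ, so the estimates differ between jobs by at most a factor Dμλ. The two floors cost at
most 1. -/
lemma HasDistortion.idc_sub_le (hI : I.HasDistortion μ) (hμ : 1 ≤ μ) (x y : ι) :
    ((I.idc μ x - I.idc μ y : ℤ) : ℝ) ≤ Real.logb 2 (I.densityRatio * μ * base μ) + 1 := by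
  have hb := base_pos hμ
  have hwx := I.weight_pos x
  have hwy := I.weight_pos y
  have hpx := I.processingTime_pos x
  have hpy := I.processingTime_pos y
  have hqx := I.prediction_pos x
  have hqy := I.prediction_pos y
  have hrx := roundedWeight_pos hμ (I.weight x)
  have hry := roundedWeight_pos hμ (I.weight y)
  have hax : 0 < I.prediction x / I.rounded μ x := by positivity
  have hay : 0 < I.prediction y / I.rounded μ y := by positivity
  have h1 : I.prediction x / I.rounded μ x ≤ I.processingTime x / I.weight x := by
    gcongr
    · exact (hI x).1
    · exact le_roundedWeight hμ hwx
  have h2 : I.processingTime y / I.weight y ≤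
      μ * base μ * (I.prediction y / I.rounded μ y) := by
    rw [div_le_iff₀ hwy]
    have h3 := roundedWeight_le hμ hwy
    have h4 := (hI y).2
    calc I.processingTime y ≤ μ * I.prediction y := h4.le
      _ = μ * (I.prediction y / I.rounded μ y) * I.rounded μ y := by field_simp
      _ ≤ μ * (I.prediction y / I.rounded μ y) * (base μ * I.weight y) := by gcongr
      _ = _ := by ring
  have h3 : I.processingTime x / I.weight x ≤
      I.densityRatio * (I.processingTime y / I.weight y) := by
    have h4 := I.le_densityRatio y x
    have h5 : I.processingTime x / I.weight x =
        I.density y / I.density x * (I.processingTime y / I.weight y) := by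
      rw [density, density]
      field_simp
    rw [h5]
    gcongr
  have hD : 0 < I.densityRatio :=
    (div_pos (I.density_pos x) (I.density_pos x)).trans_le (I.le_densityRatio x x)
  have h4 : I.prediction x / I.rounded μ x ≤
      I.densityRatio * μ * base μ * (I.prediction y / I.rounded μ y) :=
    calc _ ≤ I.densityRatio * (I.processingTime y / I.weight y) := h1.trans h3
      _ ≤ I.densityRatio * (μ * base μ * (I.prediction y / I.rounded μ y)) := by gcongr
      _ = _ := by ring
  have h5 := (Real.logb_le_logb (b := 2) (by norm_num) hax
    (hax.trans_le h4)).2 h4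
  rw [Real.logb_mul (by positivity) hay.ne'] at h5
  have h6 := Int.floor_le (Real.logb 2 (I.prediction x / I.rounded μ x))
  have h7 := Int.lt_floor_add_one (Real.logb 2 (I.prediction y / I.rounded μ y))
  push_cast
  show ((⌊_⌋ : ℤ) : ℝ) - ((⌊_⌋ : ℤ) : ℝ) ≤ _
  linarith

open Classical in
lemma HasDistortion.card_image_idc_le [Nonempty ι] (hI : I.HasDistortion μ) (hμ : 1 ≤ μ) :
    ((Finset.univ.image (I.idc μ)).card : ℝ) ≤ 7 * (1 + Real.log (μ * I.densityRatio)) := by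
  set K := Finset.univ.image (I.idc μ) with hK
  have hne : K.Nonempty := Finset.univ_nonempty.image _
  have hcard : K.card ≤ (Finset.Icc (K.min' hne) (K.max' hne)).card := by
    refine Finset.card_le_card fun k hk => Finset.mem_Icc.2 ⟨K.min'_le k hk, K.le_max' k hk⟩
  obtain ⟨x, _, hx⟩ := Finset.mem_image.1 (K.max'_mem hne)
  obtain ⟨y, _, hy⟩ := Finset.mem_image.1 (K.min'_mem hne)
  have h1 := hI.idc_sub_le hμ x y
  rw [hx, hy] at h1
  have hle : K.min' hne ≤ K.max' hne := K.min'_le _ (K.max'_mem hne)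
  rw [Int.card_Icc] at hcard
  have h2 : (K.card : ℤ) ≤ K.max' hne - K.min' hne + 1 := by omega
  have h3 : (K.card : ℝ) ≤ ((K.max' hne - K.min' hne : ℤ) : ℝ) + 1 := by exact_mod_cast h2
  have hD := I.one_le_densityRatio
  have hμD : 1 ≤ μ * I.densityRatio := by nlinarith
  have h4 : I.densityRatio * μ * base μ ≤ 2 ^ 5 * (μ * I.densityRatio) ^ 2 := by
    have h5 : base μ ≤ 2 ^ 5 * (μ * I.densityRatio) := by
      rw [base]; nlinarith
    calc I.densityRatio * μ * base μ ≤ I.densityRatio * μ * (2 ^ 5 * (μ * I.densityRatio)) := by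
          gcongr
      _ = _ := by ring
  have hb := base_pos hμ
  have h5 := (Real.logb_le_logb (b := 2) (by norm_num) (by positivity) (by positivity)).2 h4
  rw [Real.logb_mul (x := 2 ^ 5) (by positivity) (by positivity), Real.logb_pow, Real.logb_pow,
    Real.logb_self_eq_one (by norm_num)] at h5
  have hlog := Real.log_nonneg hμD
  -- Uses 1 / log 2 ≤ 3/2.
  have h6 : Real.logb 2 (μ * I.densityRatio) ≤ 3 / 2 * Real.log (μ * I.densityRatio) := by
    rw [Real.logb, div_le_iff₀ (Real.log_pos (by norm_num))]
    have := Real.log_two_gt_d9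
    nlinarith
  push_cast at h5
  linarith

end Instance

/-! ### Integration over time -/

/-- The integrands are compared pointwise; 4004 = 7 · 26 · 22, from the number of classes, the bound
per class, and λ ≤ 22μ. -/
lemma IsRun.flowTime_le [Fintype ι] {I : Instance ι} {σ τ : ℝ → Option ι} {μ : ℝ}
    (h : IsRun (weightedRule μ) I σ) (hI : I.HasDistortion μ) (hμ : 1 ≤ μ)
    (hτ : I.IsSchedule τ) :
    I.flowTime σ ≤ ENNReal.ofReal (4004 * μ ^ 3 * (1 + Real.log (μ * I.densityRatio))) *
      I.flowTime τ := by
  classical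
  rw [Instance.flowTime, Instance.flowTime, ← lintegral_const_mul' _ _ ENNReal.ofReal_ne_top]
  refine setLIntegral_mono' measurableSet_Ici fun t ht => ?_
  rcases isEmpty_or_nonempty ι with he | he
  · simp [Finset.eq_empty_of_isEmpty]
  have hlog : 0 ≤ Real.log (μ * I.densityRatio) :=
    Real.log_nonneg (by nlinarith [I.one_le_densityRatio])
  rw [← ENNReal.ofReal_mul (by positivity)]
  refine ENNReal.ofReal_le_ofReal ?_
  have hW : 0 ≤ ∑ x ∈ I.pendingJobs τ t, I.weight x :=
    Finset.sum_nonneg fun x _ => (I.weight_pos x).le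
  have h1 : ∑ x ∈ I.pendingJobs τ t, I.rounded μ x ≤
      22 * μ * ∑ x ∈ I.pendingJobs τ t, I.weight x := by
    rw [Finset.mul_sum]
    refine Finset.sum_le_sum fun x _ => (roundedWeight_le hμ (I.weight_pos x)).trans ?_
    have := (I.weight_pos x).le
    gcongr
    rw [base]
    linarith
  calc ∑ x ∈ I.pendingJobs σ t, I.weight x
      ≤ ∑ x ∈ I.pendingJobs σ t, I.rounded μ x :=
        Finset.sum_le_sum fun x _ => le_roundedWeight hμ (I.weight_pos x)
    _ ≤ (Finset.univ.image (I.idc μ)).card * (26 * μ ^ 2) *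
        ∑ x ∈ I.pendingJobs τ t, I.rounded μ x :=
        h.sum_rounded_pendingJobs_le hI hμ hτ ht
    _ ≤ 7 * (1 + Real.log (μ * I.densityRatio)) * (26 * μ ^ 2) *
        (22 * μ * ∑ x ∈ I.pendingJobs τ t, I.weight x) := by
        have := hI.card_image_idc_le hμ
        have : 0 ≤ ∑ x ∈ I.pendingJobs τ t, I.rounded μ x :=
          Finset.sum_nonneg fun x _ => (roundedWeight_pos hμ _).le
        gcongr
    _ = _ := by ring

/-! ### Existence of runs -/

/-- `σ` results from applying the rule `R` before time `T`, and is idle from time `T` on. -/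
structure IsRunUntil (R : Rule) [Fintype ι] (I : Instance ι) (σ : ℝ → Option ι) (T : ℝ) :
    Prop where
  schedule : I.IsSchedule σ
  rightConstant : ∀ t : ℝ, 0 ≤ t → t < T → ∀ᶠ s in 𝓝[≥] t, σ s = σ t
  follows : ∀ t : ℝ, 0 ≤ t → t < T → (I.pendingJobs σ t).Nonempty →
    ∃ q ∈ R ι I.weight I.prediction (I.pendingJobs σ t) {q | 0 < processed σ q t}, σ t = some q
  idle : ∀ t, T ≤ t → σ t = none

lemma eventually_eq_of_forall_Ico {σ : ℝ → Option ι} {a b : ℝ} {o : Option ι}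
    (h : ∀ s ∈ Set.Ico a b, σ s = o) {t : ℝ} (hat : a ≤ t) (htb : t < b) :
    ∀ᶠ s in 𝓝[≥] t, σ s = σ t := by
  filter_upwards [Ico_mem_nhdsGE htb] with s hs
  rw [h s ⟨hat.trans hs.1, hs.2⟩, h t ⟨hat, htb⟩]

namespace IsRunUntil

variable [Fintype ι] {I : Instance ι} {σ : ℝ → Option ι} {R : Rule} {T : ℝ}

lemma processed_eq (h : IsRunUntil R I σ T) (q : ι) {t : ℝ} (ht : T ≤ t) :
    processed σ q t = processed σ q T :=
  processed_eq_of_forall_ne σ q ht fun s hs => by simp [h.idle s hs.1.le]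

lemma isRun (h : IsRunUntil R I σ T) (hp : ¬ (I.pendingJobs σ T).Nonempty)
    (hr : ∀ x, I.release x ≤ T) : IsRun R I σ where
  schedule := h.schedule
  rightConstant t ht := by
    rcases lt_or_ge t T with htT | htT
    · exact h.rightConstant t ht htT
    · exact eventually_eq_of_forall_Ico (fun s hs => h.idle s hs.1) htT (lt_add_one t)
  follows t ht hne := by
    rcases lt_or_ge t T with htT | htT
    · exact h.follows t ht htT hne
    · obtain ⟨x, hx⟩ := hne
      have hx := (I.mem_pendingJobs.1 hx).2
      rw [Instance.remaining, h.processed_eq x htT] at hx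
      exact absurd ⟨x, I.mem_pendingJobs.2 ⟨hr x, hx⟩⟩ hp

/-- Idling until the next release. -/
lemma extend_idle (h : IsRunUntil R I σ T) (hp : ¬ (I.pendingJobs σ T).Nonempty) {T' : ℝ}
    (hT' : T ≤ T') (hr : ∀ x, T < I.release x → T' ≤ I.release x) : IsRunUntil R I σ T' where
  schedule := h.schedule
  rightConstant t ht htT' := by
    rcases lt_or_ge t T with htT | htT
    · exact h.rightConstant t ht htT
    · exact eventually_eq_of_forall_Ico (fun s hs => h.idle s hs.1) htT htT'
  follows t ht htT' hne := by
    rcases lt_or_ge t T with htT | htT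
    · exact h.follows t ht htT hne
    · obtain ⟨x, hx⟩ := hne
      obtain ⟨hxr, hx⟩ := I.mem_pendingJobs.1 hx
      rw [Instance.remaining, h.processed_eq x htT] at hx
      refine absurd ⟨x, I.mem_pendingJobs.2 ⟨?_, hx⟩⟩ hp
      by_contra! hc
      linarith [hr x hc]
  idle t ht := h.idle t (hT'.trans ht)

/-- Carrying out a decision of the rule until the job is completed or another one released. -/
lemma extend_process (h : IsRunUntil R I σ T) (hT : 0 ≤ T) {q : ι}
    (hR : ∀ P : Set ι, (P = {x | 0 < processed σ x T} ∨ P = insert q {x | 0 < processed σ x T}) →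
      q ∈ R ι I.weight I.prediction (I.pendingJobs σ T) P)
    (hq : I.IsPending σ T q) {T' : ℝ} (hTT' : T < T') (hq' : T' ≤ T + I.remaining σ q T)
    (hr : ∀ x, T < I.release x → T' ≤ I.release x) :
    ∃ τ, IsRunUntil R I τ T' ∧ processed τ q T' = processed σ q T + (T' - T) ∧
      ∀ x, processed σ x T ≤ processed τ x T' := by
  classical
  set τ : ℝ → Option ι := fun s => if s < T then σ s else if s < T' then some q else none with hτ
  have h1 : ∀ s, s < T → τ s = σ s := fun s hs => if_pos hs
  have h2 : ∀ s ∈ Set.Ico T T', τ s = some q := fun s hs => by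
    simp [hτ, not_lt.2 hs.1, hs.2]
  have h3 : ∀ s, T' ≤ s → τ s = none := fun s hs => by
    simp [hτ, not_lt.2 hs, not_lt.2 (hTT'.le.trans hs)]
  have p1 : ∀ x s, s ≤ T → processed τ x s = processed σ x s := fun x s hs =>
    processed_congr x fun u hu => by rw [h1 u (hu.trans_le hs)]
  have p2 : ∀ s ∈ Set.Icc T T', processed τ q s = processed σ q T + (s - T) := fun s hs => by
    rw [processed_eq_add_of_forall_eq τ q hT hs.1 fun u hu => h2 u ⟨hu.1, hu.2.trans_le hs.2⟩,
      p1 q T le_rfl]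
  have p3 : ∀ x, x ≠ q → ∀ s ∈ Set.Icc T T', processed τ x s = processed σ x T := by
    intro x hx s hs
    rw [processed_eq_of_forall_ne τ x hs.1, p1 x T le_rfl]
    intro u hu
    rw [h2 u ⟨hu.1.le, hu.2.trans_le hs.2⟩]
    exact fun h => hx (Option.some_injective _ h).symm
  have pend1 : ∀ x s, s ≤ T → (I.IsPending τ s x ↔ I.IsPending σ s x) := fun x s hs => by
    rw [Instance.IsPending, Instance.IsPending, Instance.remaining, Instance.remaining, p1 x s hs]
  have pend2 : ∀ x, ∀ s ∈ Set.Ico T T', (I.IsPending τ s x ↔ I.IsPending σ T x) := by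
    intro x s hs
    have hrel : I.release x ≤ s ↔ I.release x ≤ T := by
      refine ⟨fun h => ?_, fun h => h.trans hs.1⟩
      by_contra! hc
      linarith [hr x hc, hs.2]
    rw [Instance.IsPending, Instance.IsPending, hrel]
    refine and_congr_right fun _ => ?_
    by_cases hx : x = q
    · subst hx
      refine iff_of_true ?_ hq.2
      rw [Instance.remaining, p2 s ⟨hs.1, hs.2.le⟩]
      have := hs.2
      rw [Instance.remaining] at hq'
      linarith
    · rw [Instance.remaining, Instance.remaining, p3 x hx s ⟨hs.1, hs.2.le⟩]
  have pj1 : ∀ s, s ≤ T → I.pendingJobs τ s = I.pendingJobs σ s := fun s hs => by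
    ext x; rw [I.mem_pendingJobs, I.mem_pendingJobs, pend1 x s hs]
  -- Nothing is released or completed in between, so the rule sees the same pending jobs throughout.
  have pj2 : ∀ s ∈ Set.Ico T T', I.pendingJobs τ s = I.pendingJobs σ T := fun s hs => by
    ext x; rw [I.mem_pendingJobs, I.mem_pendingJobs, pend2 x s hs]
  refine ⟨τ, ⟨⟨fun x => ?_, fun s x hsx => ?_⟩, fun s hs0 hsT' => ?_, fun s hs0 hsT' hne => ?_, h3⟩,
    p2 T' ⟨hTT'.le, le_rfl⟩, fun x => ?_⟩
  · have : {s | τ s = some x} = ({s | σ s = some x} ∩ Set.Iio T) ∪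
        (Set.Ico T T' ∩ {_s | x = q}) := by
      ext s
      rcases lt_or_ge s T with hs | hs
      · simp [h1 s hs, hs, not_le.2 hs]
      · rcases lt_or_ge s T' with hs' | hs'
        · simp [h2 s ⟨hs, hs'⟩, hs, hs', not_lt.2 hs, eq_comm]
        · simp [h3 s hs', not_lt.2 hs, not_lt.2 hs']
    rw [this]
    exact ((h.schedule.measurable x).inter measurableSet_Iio).union
      (measurableSet_Ico.inter (MeasurableSet.const _))
  · rcases lt_or_ge s T with hs | hs
    · rw [h1 s hs] at hsx
      exact (pend1 x s hs.le).2 (h.schedule.pending s x hsx)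
    · rcases lt_or_ge s T' with hs' | hs'
      · rw [h2 s ⟨hs, hs'⟩] at hsx
        obtain rfl := Option.some_injective _ hsx
        exact (pend2 q s ⟨hs, hs'⟩).2 hq
      · rw [h3 s hs'] at hsx
        exact absurd hsx (by simp)
  · rcases lt_or_ge s T with hs | hs
    · filter_upwards [h.rightConstant s hs0 hs, Ico_mem_nhdsGE hs] with u hu hu'
      rw [h1 u hu'.2, h1 s hs, hu]
    · exact eventually_eq_of_forall_Ico h2 hs hsT'
  · rcases lt_or_ge s T with hs | hs
    · rw [pj1 s hs.le] at hne ⊢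
      simp only [p1 _ s hs.le, h1 s hs]
      exact h.follows s hs0 hs hne
    · refine ⟨q, ?_, h2 s ⟨hs, hsT'⟩⟩
      rw [pj2 s ⟨hs, hsT'⟩]
      apply hR
      rcases hs.eq_or_lt with rfl | hs
      · left
        simp only [p1 _ T le_rfl]
      -- After time `T` the only change visible to the rule is that `q` has become partial.
      · right
        ext x
        by_cases hx : x = q
        · subst hx
          have := processed_nonneg σ x T
          simp only [Set.mem_ofPred_eq, Set.mem_insert_iff, true_or, iff_true,
            p2 s ⟨hs.le, hsT'.le⟩]
          linarith
        · simp [hx, p3 x hx s ⟨hs.le, hsT'.le⟩]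
  · rw [← p1 x T le_rfl]
    exact processed_mono τ x hTT'.le

end IsRunUntil

/-- A rule that always permits some pending job, and sticks to its decisions, has a run. -/
lemma exists_isRun {R : Rule} [Fintype ι] (I : Instance ι)
    (hne : ∀ (alive : Finset ι) (P : Set ι), alive.Nonempty →
      (R ι I.weight I.prediction alive P).Nonempty)
    (hmem : ∀ (alive : Finset ι) (P : Set ι), ∀ q ∈ R ι I.weight I.prediction alive P, q ∈ alive)
    (hins : ∀ (alive : Finset ι) (P : Set ι), ∀ q ∈ R ι I.weight I.prediction alive P,
      q ∈ R ι I.weight I.prediction alive (insert q P)) :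
    ∃ σ, IsRun R I σ := by
  classical
  -- Induction on the number of unreleased jobs plus the number of unfinished ones; each extension
  -- ends at a release or a completion and lowers this count.
  suffices H : ∀ (n : ℕ) (σ : ℝ → Option ι) (T : ℝ), 0 ≤ T → IsRunUntil R I σ T →
      (Finset.univ.filter fun x => T < I.release x).card +
        (Finset.univ.filter fun x => 0 < I.remaining σ x T).card ≤ n → ∃ σ, IsRun R I σ by
    refine H _ (fun _ => none) 0 le_rfl ⟨⟨by simp, by simp⟩, ?_, ?_, by simp⟩ le_rfl
    · intro t h1 h2; linarith
    · intro t h1 h2; linarith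
  intro n
  induction n with
  | zero =>
    intro σ T hT h hn
    have h1 := Finset.card_eq_zero.1 (Nat.eq_zero_of_add_eq_zero_right (Nat.le_zero.1 hn))
    have h2 := Finset.card_eq_zero.1 (Nat.eq_zero_of_add_eq_zero_left (Nat.le_zero.1 hn))
    refine ⟨σ, h.isRun ?_ fun x => ?_⟩
    · rintro ⟨x, hx⟩
      exact Finset.filter_eq_empty_iff.1 h2 (Finset.mem_univ x) (I.mem_pendingJobs.1 hx).2
    · exact not_lt.1 (Finset.filter_eq_empty_iff.1 h1 (Finset.mem_univ x))
  | succ n ih =>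
    intro σ T hT h hn
    have next : (∀ x, I.release x ≤ T) ∨ ∃ y, T < I.release y ∧
        ∀ x, T < I.release x → I.release y ≤ I.release x := by
      by_cases hall : ∀ x, I.release x ≤ T
      · exact Or.inl hall
      · right
        push Not at hall
        obtain ⟨z, hz⟩ := hall
        obtain ⟨y, hy, hmin⟩ := (Finset.univ.filter fun x => T < I.release x).exists_min_image
          I.release ⟨z, Finset.mem_filter.2 ⟨Finset.mem_univ _, hz⟩⟩
        exact ⟨y, (Finset.mem_filter.1 hy).2, fun x hx =>
          hmin x (Finset.mem_filter.2 ⟨Finset.mem_univ _, hx⟩)⟩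
    have step : ∀ (τ : ℝ → Option ι) (T' : ℝ), T < T' → IsRunUntil R I τ T' →
        (∀ x, processed σ x T ≤ processed τ x T') →
        ((∃ y, T < I.release y ∧ T' = I.release y) ∨
          ∃ q, 0 < I.remaining σ q T ∧ I.remaining τ q T' ≤ 0) → ∃ σ, IsRun R I σ := by
      intro τ T' hTT' hτ hproc hdec
      refine ih τ T' (hT.trans hTT'.le) hτ ?_
      have s1 : (Finset.univ.filter fun x => T' < I.release x) ⊆
          Finset.univ.filter fun x => T < I.release x :=
        Finset.monotone_filter_right _ fun x _ hx => hTT'.trans hx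
      have s2 : (Finset.univ.filter fun x => 0 < I.remaining τ x T') ⊆
          Finset.univ.filter fun x => 0 < I.remaining σ x T :=
        Finset.monotone_filter_right _ fun x _ hx => by
          have := hproc x
          rw [Instance.remaining] at *
          linarith
      have c1 := Finset.card_le_card s1
      have c2 := Finset.card_le_card s2
      rcases hdec with ⟨y, hy, hyT'⟩ | ⟨q, hq, hq'⟩
      · have := Finset.card_lt_card ((Finset.ssubset_iff_of_subset s1).2
          ⟨y, by simpa using hy, by simp [hyT']⟩)
        omega
      · have := Finset.card_lt_card ((Finset.ssubset_iff_of_subset s2).2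
          ⟨q, by simpa using hq, by simpa using hq'⟩)
        omega
    by_cases hp : (I.pendingJobs σ T).Nonempty
    · obtain ⟨q, hq⟩ := hne _ {x | 0 < processed σ x T} hp
      have hqp := I.mem_pendingJobs.1 (hmem _ _ q hq)
      have hR : ∀ P : Set ι,
          (P = {x | 0 < processed σ x T} ∨ P = insert q {x | 0 < processed σ x T}) →
          q ∈ R ι I.weight I.prediction (I.pendingJobs σ T) P := by
        rintro P (rfl | rfl)
        · exact hq
        · exact hins _ _ q hq
      have finish : (∀ x, T < I.release x → T + I.remaining σ q T ≤ I.release x) →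
          ∃ σ, IsRun R I σ := by
        intro hr
        have hlt : T < T + I.remaining σ q T := lt_add_of_pos_right _ hqp.2
        obtain ⟨τ, h1, h2, h3⟩ := h.extend_process hT hR hqp hlt le_rfl hr
        refine step τ _ hlt h1 h3 (Or.inr ⟨q, hqp.2, ?_⟩)
        rw [Instance.remaining, h2, Instance.remaining]
        linarith
      rcases next with hr | ⟨y, hy, hmin⟩
      · exact finish fun x hx => absurd hx (not_lt.2 (hr x))
      · rcases le_total (I.release y) (T + I.remaining σ q T) with hle | hle
        · obtain ⟨τ, h1, -, h3⟩ := h.extend_process hT hR hqp hy hle hmin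
          exact step τ _ hy h1 h3 (Or.inl ⟨y, hy, rfl⟩)
        · exact finish fun x hx => hle.trans (hmin x hx)
    · rcases next with hr | ⟨y, hy, hmin⟩
      · exact ⟨σ, h.isRun hp hr⟩
      · exact step σ _ hy (h.extend_idle hp hy.le hmin) (fun x => processed_mono σ x hy.le)
          (Or.inl ⟨y, hy, rfl⟩)

/-- The class choices ignore partiality, and a partial job meets the preference automatically; so a
decision remains permitted while it is carried out. -/
lemma mem_weightedRule_insert {μ : ℝ} {weight prediction : ι → ℝ} {alive : Finset ι}
    {partialJobs : Set ι} {q : ι}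
    (h : q ∈ weightedRule μ ι weight prediction alive partialJobs) :
    q ∈ weightedRule μ ι weight prediction alive (insert q partialJobs) := by
  obtain ⟨i, j, i', hi, hj, hi', hq, _⟩ := h
  exact ⟨i, j, i', hi, hj, hi', hq, fun _ => Set.mem_insert _ _⟩

end SPPT

end

theorem mainTheorem2 :
    ∃ C : ℝ, 0 < C ∧ ∀ μ : ℝ, 1 ≤ μ →
      SPPT.IsRobustCompetitive (SPPT.weightedRule μ) μ
        (fun _ _ I => C * μ ^ 3 * (1 + Real.log (μ * I.densityRatio))) := by
  refine ⟨4004, by norm_num, fun μ hμ ι _ I hI => ⟨?_, fun σ hσ => ?_⟩⟩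
  · exact SPPT.exists_isRun I (fun _ _ h => SPPT.weightedRule_nonempty hμ _ _ h _)
      (fun _ _ _ h => SPPT.mem_alive_of_mem_weightedRule h)
      fun _ _ _ h => SPPT.mem_weightedRule_insert h
  · have : Nonempty {τ : ℝ → Option ι // I.IsSchedule τ} := ⟨⟨σ, hσ.schedule⟩⟩
    rw [SPPT.Instance.opt, ENNReal.mul_iInf fun h => absurd h ENNReal.ofReal_ne_top]
    exact le_iInf fun τ => hσ.flowTime_le hI hμ τ.2
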